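/- Let $T>0$ and $\mathbb T^2=(\mathbb R/2\pi\mathbb Z)^2$, and write $L^p_tL^2_x=L^p((0,T);L^2(\mathbb T^2;\mathbb R^2))$. Definitions. All initial data lie in $L^2(\mathbb T^2)$, all forces lie in $L^1_tL^2_x$, and both are divergence-free. A weak solution of the Euler ($\nu=0$) or Navier–Stokes ($\nu>0$) equations $$\partial_tu+u\cdot\nabla u+\nabla p=\nu\Delta u+f,\qquad \operatorname{div}u=0,\qquad u(0)=u_0,$$ is a field $u\in L^\infty_tL^2_x$ (with in addition $u\in L^2((0,T);H^1(\mathbb T^2))$ if $\nu>0$) that is divergence-free in the sense of distributions for almost every $t$ and satisfies $$\int_0^T\!\!\int_{\mathbb T^2}\big(u\cdot\partial_t\psi+u\otimes u:\nabla\psi+\nu\,u\cdot\Delta\psi\big)\,dx\,dt+\int_{\mathbb T^2}u_0\cdot\psi(\cdot,0)\,dx=-\int_0^T\!\!\int_{\mathbb T^2}f\cdot\psi\,dx\,dt$$ for all divergence-free $\psi\in C_c^\infty(\mathbb T^2\times[0,T);\mathbb R^2)$. A weak solution $u$ of the Euler equations is energy balanced if $\frac12\|u(t)\|_{L^2}^2=\frac12\|u_0\|_{L^2}^2+\int_0^t\langle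 f,u\rangle_{L^2}\,d\tau$ for almost every $t\in(0,T)$. It is physically realizable if there are a sequence of viscosities $\nu\to0^+$, data $u_0^\nu\to u_0$ strongly in $L^2$, forces $f^\nu\rightharpoonup f$ weakly in $L^1_tL^2_x$, and weak solutions $u^\nu$ of the corresponding Navier–Stokes equations with $u^\nu\rightharpoonup u$ weakly-$*$ in $L^\infty_tL^2_x$; then $(u^\nu)$ is called a physical realization of $u$. Statement. The zero field $u\equiv0$ is a physically realizable and energy balanced weak solution of the Euler equations with $u_0=0$ and force $f\equiv0$. Let $\phi\in C^\infty(\mathbb R)$ be not identically zero and supported in $[1/2,1]$, and let $\gamma\in C_c^\infty((0,\infty))$ be not identically zero on $(0,T)$; such $\phi,\gamma$ exist. For $\nu>0$ define on $\mathbb T^2$, identified with $(-\pi,\pi]^2$, with $x^\perp=(-x_2,x_1)$, $$u^\nu(x,t)=\frac{x^\perp}{|x|^2}\sin\Big(\frac{|x|}{\nu^{1/3}}\Big)\phi(|x|)\gamma(t),\qquad f^\nu=\partial_tu^\nu-\nu\Delta u^\nu .$$ Then, along every sequence $\nu\to0^+$, $(u^\nu)$, with the forces $f^\nu$ and initial data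 $u^\nu_0=u^\nu(\cdot,0)=0$, is a physical realization of $u\equiv0$, and $f^\nu\rightharpoonup0$ weakly in $L^2_tL^2_x$, but $u^\nu$ does not converge strongly to $0$ in $L^2_tL^2_x$ (nor, therefore, in $C([0,T];L^2(\mathbb T^2))$). Consequently, the following implication is false: if $u$ is an energy balanced weak solution of the Euler equations with force $f$, $(u^\nu)$ is a physical realization of $u$ with forces $f^\nu$, and $f^\nu\rightharpoonup f$ weakly in $L^2_tL^2_x$, then $u^\nu\to u$ strongly in $L^2_tL^2_x$. That is, in the theorem asserting the equivalence of energy balance of $u$ and strong convergence $u^\nu\to u$ when $f^\nu\to f$ strongly in $L^2_tL^2_x$, strong convergence of the forces cannot be weakened to weak convergence. -/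

import Mathlib

open MeasureTheory Filter Topology Set
open scoped ENNReal ContDiff

noncomputable section

instance factTwoPiPos : Fact (0 < 2 * Real.pi) := ⟨Real.two_pi_pos⟩

/-- The Euclidean plane. -/
abbrev Plane : Type := EuclideanSpace ℝ (Fin 2)

/-- The flat torus `(ℝ / 2πℤ)²`, with its Lebesgue measure of total mass `(2π)²`. -/
abbrev FlatTorus : Type := Fin 2 → AddCircle (2 * Real.pi)

/-- The quotient map from the plane to the torus. -/
def torusProj (y : Plane) : FlatTorus := fun i => (y i : AddCircle (2 * Real.pi))

/-- The representative of a point of the torus in the cell `(-π, π]²`. -/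
def torusRep (x : FlatTorus) : Plane :=
  WithLp.toLp 2 fun i => (AddCircle.equivIoc (2 * Real.pi) (-Real.pi) (x i) : ℝ)

section Calculus

variable {F : Type*} [NormedAddCommGroup F] [NormedSpace ℝ F]

/-- The function on the torus is smooth, i.e. its periodic lift to the plane is smooth. -/
def TorusSmooth (g : FlatTorus → F) : Prop :=
  ContDiff ℝ ∞ fun y : Plane => g (torusProj y)

/-- The differential at `x` of a function on the torus (of its lift to the plane). -/
def torusFDeriv (g : FlatTorus → F) (x : FlatTorus) : Plane →L[ℝ] F :=
  fderiv ℝ (fun y : Plane => g (torusProj y)) (torusRep x)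

/-- The Laplacian at `x` of a function on the torus (of its lift to the plane). -/
def torusLaplacian (g : FlatTorus → F) (x : FlatTorus) : F :=
  Laplacian.laplacian (fun y : Plane => g (torusProj y)) (torusRep x)

end Calculus

/-- `L²(𝕋²; ℝ²)`, square integrable vector fields on the torus. -/
abbrev L2Field : Type := Lp Plane 2 (volume : Measure FlatTorus)

/-- Lebesgue measure on the time interval `(0, T)`. -/
abbrev timeMeasure (T : ℝ) : Measure ℝ := volume.restrict (Ioo 0 T)

/-- `div v = 0` in the sense of distributions: `∫ v · ∇ψ = 0` for all smooth scalar `ψ`. -/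
def IsDivFree (v : L2Field) : Prop :=
  ∀ ψ : FlatTorus → ℝ, TorusSmooth ψ → ∫ x, torusFDeriv ψ x (v x) = 0

/-- `w` is the weak partial derivative `∂ᵢ v` of the vector field `v`. -/
def IsWeakPartial (i : Fin 2) (v w : L2Field) : Prop :=
  ∀ ψ : FlatTorus → Plane, TorusSmooth ψ →
    ∫ x, inner ℝ (v x) (torusFDeriv ψ x (EuclideanSpace.single i 1)) =
      -∫ x, inner ℝ (w x) (ψ x)

/-- `u ∈ L²(0,T; H¹(𝕋²))`: `u` and its weak partial derivatives lie in `L²(0,T; L²(𝕋²))`. -/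
def MemL2H1 (T : ℝ) (u : ℝ → L2Field) : Prop :=
  MemLp u 2 (timeMeasure T) ∧
    ∀ i : Fin 2, ∃ w : ℝ → L2Field, MemLp w 2 (timeMeasure T) ∧
      ∀ᵐ t ∂timeMeasure T, IsWeakPartial i (u t) (w t)

/-- Divergence-free test vector fields `φ ∈ C_c^∞(𝕋² × [0,T))`. Only the values at times `t ≥ 0`
matter below; smoothness up to `t = 0` is expressed by a smooth extension to negative times. -/
structure IsTestField (T : ℝ) (φ : ℝ → FlatTorus → Plane) : Prop where
  smooth : ContDiff ℝ ∞ fun p : ℝ × Plane => φ p.1 (torusProj p.2)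
  support : ∃ S < T, ∀ t, S ≤ t → ∀ x, φ t x = 0
  divFree : ∀ t x, ∑ i : Fin 2, torusFDeriv (φ t) x (EuclideanSpace.single i 1) i = 0

/-- The weak form of `∂ₜu + u·∇u + ∇p = ν Δu + f`, `u(0) = u₀`, on `𝕋² × (0,T)`:
`∫∫ (u·∂ₜφ + u⊗u:∇φ + ν u·Δφ) dx dt + ∫ u₀·φ(0) dx = -∫∫ f·φ dx dt`
for all divergence-free test fields; here `u⊗u:∇φ = u · (Dφ u)`. -/
def WeakMomentum (ν T : ℝ) (u₀ : L2Field) (f u : ℝ → L2Field) : Prop :=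
  ∀ φ : ℝ → FlatTorus → Plane, IsTestField T φ →
    (∫ t in Ioo 0 T, ∫ x, (inner ℝ (u t x) (deriv (fun s => φ s x) t)
          + inner ℝ (u t x) (torusFDeriv (φ t) x (u t x))
          + ν * inner ℝ (u t x) (torusLaplacian (φ t) x)))
        + ∫ x, inner ℝ (u₀ x) (φ 0 x)
      = -∫ t in Ioo 0 T, ∫ x, inner ℝ (f t x) (φ t x)

/-- Admissible data: `u₀ ∈ L²(𝕋²)` and `f ∈ L¹(0,T; L²(𝕋²))`, both divergence-free. -/
def IsFlowData (T : ℝ) (u₀ : L2Field) (f : ℝ → L2Field) : Prop :=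
  IsDivFree u₀ ∧ MemLp f 1 (timeMeasure T) ∧ ∀ᵐ t ∂timeMeasure T, IsDivFree (f t)

/-- Weak solutions `u ∈ L^∞(0,T; L²(𝕋²))` of the incompressible Euler equations. -/
structure IsEulerSolution (T : ℝ) (u₀ : L2Field) (f u : ℝ → L2Field) : Prop where
  data : IsFlowData T u₀ f
  memLp : MemLp u ∞ (timeMeasure T)
  momentum : WeakMomentum 0 T u₀ f u
  divFree : ∀ᵐ t ∂timeMeasure T, IsDivFree (u t)

/-- (Leray) weak solutions `u ∈ L^∞(0,T; L²(𝕋²)) ∩ L²(0,T; H¹(𝕋²))` of the incompressible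
Navier-Stokes equations with viscosity `ν`. -/
structure IsNavierStokesSolution (ν T : ℝ) (u₀ : L2Field) (f u : ℝ → L2Field) : Prop where
  data : IsFlowData T u₀ f
  memLp : MemLp u ∞ (timeMeasure T)
  memL2H1 : MemL2H1 T u
  momentum : WeakMomentum ν T u₀ f u
  divFree : ∀ᵐ t ∂timeMeasure T, IsDivFree (u t)

/-- Energy balanced weak solutions of the Euler equations. -/
def IsEnergyBalanced (T : ℝ) (u₀ : L2Field) (f u : ℝ → L2Field) : Prop :=
  IsEulerSolution T u₀ f u ∧
    ∀ᵐ t ∂timeMeasure T,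
      (1 / 2 : ℝ) * ‖u t‖ ^ 2 = (1 / 2 : ℝ) * ‖u₀‖ ^ 2 + ∫ s in Ioo 0 t, inner ℝ (f s) (u s)

/-- Weak convergence in `L^p(0,T; L²(𝕋²))`: convergence against every continuous linear
functional (membership in the space being part of the assertion). -/
def WeakTendsto (p : ℝ≥0∞) [Fact (1 ≤ p)] (T : ℝ) (g : ℕ → ℝ → L2Field) (h : ℝ → L2Field) :
    Prop :=
  ∃ (hg : ∀ n, MemLp (g n) p (timeMeasure T)) (hh : MemLp h p (timeMeasure T)),
    ∀ ℓ : StrongDual ℝ (Lp L2Field p (timeMeasure T)),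
      Tendsto (fun n => ℓ ((hg n).toLp (g n))) atTop (𝓝 (ℓ (hh.toLp h)))

/-- Weak-* convergence in `L^∞(0,T; L²(𝕋²))`, the dual of `L¹(0,T; L²(𝕋²))`. -/
def WeakStarTendsto (T : ℝ) (g : ℕ → ℝ → L2Field) (h : ℝ → L2Field) : Prop :=
  (∀ n, MemLp (g n) ∞ (timeMeasure T)) ∧ MemLp h ∞ (timeMeasure T) ∧
    ∀ w : ℝ → L2Field, MemLp w 1 (timeMeasure T) →
      Tendsto (fun n => ∫ t in Ioo 0 T, inner ℝ (g n t) (w t)) atTop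
        (𝓝 (∫ t in Ioo 0 T, inner ℝ (h t) (w t)))

/-- Strong convergence in `L²(0,T; L²(𝕋²))`. It is only used for `g n` and `h` that are known to
lie in `L^∞(0,T; L²(𝕋²))`, hence in `L²(0,T; L²(𝕋²))`. -/
def StrongL2Tendsto (T : ℝ) (g : ℕ → ℝ → L2Field) (h : ℝ → L2Field) : Prop :=
  Tendsto (fun n => eLpNorm (fun t => g n t - h t) 2 (timeMeasure T)) atTop (𝓝 0)

/-- The solutions `uν n` of the Navier-Stokes equations with viscosities `ν n → 0`, initial data
`uν₀ n` and forces `fν n` are a physical realization of the weak solution `u` of the Euler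
equations with initial datum `u₀` and force `f`. -/
structure IsPhysicalRealization (T : ℝ) (u₀ : L2Field) (f u : ℝ → L2Field)
    (ν : ℕ → ℝ) (uν₀ : ℕ → L2Field) (fν uν : ℕ → ℝ → L2Field) : Prop where
  euler : IsEulerSolution T u₀ f u
  viscosity_pos : ∀ n, 0 < ν n
  viscosity_tendsto : Tendsto ν atTop (𝓝 0)
  navierStokes : ∀ n, IsNavierStokesSolution (ν n) T (uν₀ n) (fν n) (uν n)
  initial_tendsto : Tendsto uν₀ atTop (𝓝 u₀)
  force_tendsto : WeakTendsto 1 T fν f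
  velocity_tendsto : WeakStarTendsto T uν u

/-- Physically realizable weak solutions of the Euler equations. -/
def IsPhysicallyRealizable (T : ℝ) (u₀ : L2Field) (f u : ℝ → L2Field) : Prop :=
  ∃ ν uν₀ fν uν, IsPhysicalRealization T u₀ f u ν uν₀ fν uν

/-- The profiles: `φ` is smooth, not identically zero, and supported on `[1/2, 1]`;
`γ ∈ C_c^∞((0,∞))` does not vanish identically on `(0,T)`. -/
structure IsProfilePair (T : ℝ) (φ γ : ℝ → ℝ) : Prop where
  smooth_radial : ContDiff ℝ ∞ φ
  support_radial : Function.support φ ⊆ Icc (1 / 2) 1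
  ne_zero_radial : ∃ r, φ r ≠ 0
  smooth_time : ContDiff ℝ ∞ γ
  compact_time : HasCompactSupport γ
  support_time : tsupport γ ⊆ Ioi 0
  ne_zero_time : ∃ t ∈ Ioo 0 T, γ t ≠ 0

/-- `y^⊥ = (-y₂, y₁)`. -/
def planePerp (y : Plane) : Plane := !₂[-y 1, y 0]

/-- The oscillating vortex `u^ν(x,t) = (x^⊥ / |x|²) sin(|x| / ν^{1/3}) φ(|x|) γ(t)`, with `x` in
the cell `(-π, π]²`. -/
def vortexVelocity (φ γ : ℝ → ℝ) (ν t : ℝ) (x : FlatTorus) : Plane :=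
  (Real.sin (‖torusRep x‖ / ν ^ (1 / 3 : ℝ)) * φ ‖torusRep x‖ * γ t / ‖torusRep x‖ ^ 2) •
    planePerp (torusRep x)

/-- The force `f^ν = ∂ₜ u^ν - ν Δ u^ν` of the oscillating vortex. -/
def vortexForce (φ γ : ℝ → ℝ) (ν t : ℝ) (x : FlatTorus) : Plane :=
  deriv (fun s => vortexVelocity φ γ ν s x) t - ν • torusLaplacian (vortexVelocity φ γ ν t) x

end

/-! The counterexample rests on a mismatch of scales. A circular flow `q(|y|²) y^⊥` is
divergence-free, its self-advection is centripetal, hence a pressure gradient, and its Laplacian is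
again a circular flow. So a circular flow times a function of time solves Navier–Stokes exactly once
the force is taken to be `∂ₜu - νΔu`, which is itself divergence-free
(`integral_convection_swirl_eq_zero`, `laplacian_swirl`, `weakMomentum_field`).

Let the radial profile oscillate with frequency `κ = ν^(-1/3)`. By the Riemann–Lebesgue lemma in
polar coordinates the flow tends weakly to zero (`IsAnnular.tendsto_inner_field`), and so does
`∂ₜu`, where only the time factor is differentiated. The Laplacian costs `κ²`, so the viscous force
has size `ν κ² = ν^(1/3)` and vanishes strongly (`IsAnnular.tendsto_viscous_field`). Yet `sin²` has
mean `1/2`, so half of the energy of the envelope survives in the limit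
(`IsAnnular.tendsto_norm_field`), which rules out strong convergence.

Everything in space lives in the unit disk, well inside the cell `(-π, π]²`; integrals over the
torus therefore become integrals over the plane, where integration by parts has no boundary terms.
-/

/-! ### The fundamental cell and fields supported in the unit disk -/

theorem neg_pi_add_two_pi : -Real.pi + 2 * Real.pi = Real.pi := by ring

/-- The cell `(-π, π]²`. -/
def torusCell : Set Plane := {y | ∀ i, y i ∈ Ioc (-Real.pi) Real.pi}

theorem measurableSet_torusCell : MeasurableSet torusCell := by
  have : torusCell = ⋂ i : Fin 2, (fun y : Plane => y i) ⁻¹' Ioc (-Real.pi) Real.pi := by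
    ext y; simp [torusCell]
  rw [this]
  exact MeasurableSet.iInter fun i =>
    (PiLp.continuous_apply 2 _ i).measurable measurableSet_Ioc

theorem torusRep_mem_cell (x : FlatTorus) : torusRep x ∈ torusCell := by
  intro i
  have := (AddCircle.equivIoc (2 * Real.pi) (-Real.pi) (x i)).2
  exact ⟨this.1, this.2.trans_eq neg_pi_add_two_pi⟩

theorem torusProj_torusRep (x : FlatTorus) : torusProj (torusRep x) = x := by
  funext i
  exact AddCircle.coe_equivIoc

theorem torusRep_torusProj {y : Plane} (hy : y ∈ torusCell) : torusRep (torusProj y) = y := by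
  ext i
  refine AddCircle.equivIoc_coe_of_mem (p := 2 * Real.pi) (a := -Real.pi) ?_
  rw [neg_pi_add_two_pi]
  exact hy i

theorem range_torusRep : range torusRep = torusCell := by
  ext y
  exact ⟨fun ⟨x, hx⟩ => hx ▸ torusRep_mem_cell x, fun hy => ⟨_, torusRep_torusProj hy⟩⟩

theorem continuous_torusProj : Continuous torusProj :=
  continuous_pi fun i =>
    (AddCircle.continuous_mk' (2 * Real.pi)).comp (PiLp.continuous_apply 2 _ i)

theorem measurePreserving_torusRep :
    MeasurePreserving torusRep volume (volume.restrict torusCell) := by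
  have h1 : MeasurePreserving
      (fun x : AddCircle (2 * Real.pi) => (AddCircle.equivIoc (2 * Real.pi) (-Real.pi) x : ℝ))
      volume (volume.restrict (Ioc (-Real.pi) (-Real.pi + 2 * Real.pi))) :=
    (measurePreserving_subtype_coe measurableSet_Ioc).comp
      (AddCircle.measurePreserving_equivIoc (2 * Real.pi))
  have h2 := measurePreserving_pi (fun _ : Fin 2 => (volume : Measure (AddCircle (2 * Real.pi))))
    (fun _ : Fin 2 => volume.restrict (Ioc (-Real.pi) (-Real.pi + 2 * Real.pi))) (fun _ => h1)
  rw [← Measure.restrict_pi_pi] at h2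
  have h3 := (PiLp.volume_preserving_toLp (Fin 2)).restrict_preimage measurableSet_torusCell
  have h4 : (WithLp.toLp 2) ⁻¹' torusCell =
      univ.pi fun _ : Fin 2 => Ioc (-Real.pi) (-Real.pi + 2 * Real.pi) := by
    ext y
    simp [torusCell, two_mul]
  rw [h4] at h3
  exact h3.comp h2

theorem measurableEmbedding_torusRep : MeasurableEmbedding torusRep := by
  refine .of_measurable_inverse measurePreserving_torusRep.measurable
    (range_torusRep ▸ measurableSet_torusCell) continuous_torusProj.measurable
    torusProj_torusRep

/-- The function vanishes outside the closed unit disk. -/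
def DiskSupported {E : Type*} [Zero E] (K : Plane → E) : Prop :=
  ∀ y, 1 < ‖y‖ → K y = 0

theorem mem_torusCell_of_norm_le_one {y : Plane} (hy : ‖y‖ ≤ 1) : y ∈ torusCell := by
  intro i
  have h := (PiLp.norm_apply_le y i).trans hy
  rw [Real.norm_eq_abs, abs_le] at h
  exact ⟨by linarith [Real.pi_gt_three], by linarith [Real.pi_gt_three]⟩

theorem DiskSupported.eq_zero_of_notMem_cell {E : Type*} [Zero E] {K : Plane → E}
    (hK : DiskSupported K) {y : Plane} (hy : y ∉ torusCell) : K y = 0 :=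
  hK y (not_le.1 fun h => hy (mem_torusCell_of_norm_le_one h))

theorem DiskSupported.hasCompactSupport {E : Type*} [Zero E] {K : Plane → E}
    (hK : DiskSupported K) : HasCompactSupport K := by
  refine HasCompactSupport.intro (isCompact_closedBall (0 : Plane) 1) fun y hy => hK y ?_
  simpa using hy

theorem DiskSupported.fderiv {E : Type*} [NormedAddCommGroup E] [NormedSpace ℝ E]
    {K : Plane → E} (hK : DiskSupported K) : DiskSupported (fderiv ℝ K) := by
  intro y hy
  have : K =ᶠ[𝓝 y] fun _ => 0 := by
    filter_upwards [continuous_norm.continuousAt.eventually (lt_mem_nhds hy)] with z hz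
    exact hK z hz
  rw [this.fderiv_eq]
  simp

/-! ### Transfer of integrals from the torus to the plane -/

section Integral

variable {E : Type*} [NormedAddCommGroup E]

theorem integral_comp_torusRep [NormedSpace ℝ E] {K : Plane → E} (hK : DiskSupported K) :
    ∫ x, K (torusRep x) = ∫ y, K y := by
  rw [measurePreserving_torusRep.integral_comp measurableEmbedding_torusRep]
  exact setIntegral_eq_integral_of_forall_compl_eq_zero fun y hy => hK.eq_zero_of_notMem_cell hy

theorem integrable_comp_torusRep {K : Plane → E} (hK : DiskSupported K) :
    Integrable (fun x => K (torusRep x)) ↔ Integrable K := by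
  have h := measurePreserving_torusRep.integrable_comp_emb measurableEmbedding_torusRep (g := K)
  rw [show (fun x => K (torusRep x)) = K ∘ torusRep from rfl, h]
  exact ⟨fun h => IntegrableOn.integrable_of_forall_notMem_eq_zero h
    fun y hy => hK.eq_zero_of_notMem_cell hy, fun h => h.integrableOn⟩

theorem memLp_comp_torusRep {K : Plane → E} (hc : Continuous K) (hK : DiskSupported K)
    (p : ℝ≥0∞) : MemLp (fun x => K (torusRep x)) p volume := by
  obtain ⟨C, hC⟩ := hc.bounded_above_of_compact_support hK.hasCompactSupport
  refine MemLp.of_bound ?_ C (ae_of_all _ fun x => hC _)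
  exact (hc.stronglyMeasurable_of_hasCompactSupport hK.hasCompactSupport).aestronglyMeasurable.comp_measurable
    measurePreserving_torusRep.measurable

end Integral

/-! ### Periodic lifts of disk-supported fields -/

section Periodization

variable {F : Type*}

/-- The representative jumps across the edge of the cell, but the modulus of each coordinate is the
quotient norm and so depends continuously on `y`. -/
theorem norm_torusProj_apply (y : Plane) (i : Fin 2) :
    ‖torusProj y i‖ = |torusRep (torusProj y) i| := by
  have h : torusProj y i = ((torusRep (torusProj y) i : ℝ) : AddCircle (2 * Real.pi)) :=
    (congrFun (torusProj_torusRep (torusProj y)) i).symm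
  rw [h, AddCircle.norm_coe_eq_abs_iff _ Real.two_pi_pos.ne']
  have := torusRep_mem_cell (torusProj y) i
  rw [abs_of_pos Real.two_pi_pos, abs_le]
  constructor <;> linarith [this.1, this.2]

/-- Near a point of the cell, the periodization of a function supported in the unit disk agrees
with the function itself. -/
theorem DiskSupported.lift_eventuallyEq [Zero F] {G : Plane → F} (hG : DiskSupported G)
    (x : FlatTorus) :
    (fun y => G (torusRep (torusProj y))) =ᶠ[𝓝 (torusRep x)] G := by
  by_cases hx : ∀ i, |torusRep x i| < Real.pi
  · have hopen : ∀ᶠ y in 𝓝 (torusRep x), ∀ i, |y i| < Real.pi := by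
      rw [eventually_all]
      exact fun i => ((PiLp.continuous_apply 2 _ i).abs.continuousAt.eventually
        (gt_mem_nhds (hx i)))
    filter_upwards [hopen] with y hy
    rw [torusRep_torusProj fun i => ⟨(abs_lt.1 (hy i)).1, (abs_lt.1 (hy i)).2.le⟩]
  -- At an edge point some coordinate has modulus at least `π > 1`. Nearby, that coordinate exceeds
  -- `1` in modulus both for `y` and, by continuity of the quotient norm, for its representative;
  -- both sides then vanish.
  · push Not at hx
    obtain ⟨i, hi⟩ := hx
    have h1 : 1 < |torusRep x i| := by linarith [Real.pi_gt_three]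
    have h2 : 1 < ‖torusProj (torusRep x) i‖ := by
      rw [norm_torusProj_apply, torusProj_torusRep]; exact h1
    have e1 : ∀ᶠ y in 𝓝 (torusRep x), 1 < |y i| :=
      (PiLp.continuous_apply 2 _ i).abs.continuousAt.eventually (lt_mem_nhds h1)
    have e2 : ∀ᶠ y in 𝓝 (torusRep x), 1 < ‖torusProj y i‖ :=
      (((continuous_apply i).comp continuous_torusProj).norm.continuousAt.eventually
        (lt_mem_nhds h2))
    filter_upwards [e1, e2] with y h1 h2
    rw [norm_torusProj_apply] at h2
    rw [hG _ (h1.trans_le (PiLp.norm_apply_le y i)),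
      hG _ (h2.trans_le (PiLp.norm_apply_le (torusRep (torusProj y)) i))]

variable [NormedAddCommGroup F] [NormedSpace ℝ F]

theorem DiskSupported.torusLaplacian_eq {G : Plane → F} (hG : DiskSupported G) (x : FlatTorus) :
    torusLaplacian (fun x => G (torusRep x)) x = Laplacian.laplacian G (torusRep x) :=
  (InnerProductSpace.laplacian_congr_nhds (hG.lift_eventuallyEq x)).eq_of_nhds

end Periodization

/-- The coordinate vectors of the plane. -/
noncomputable abbrev planeBasis (i : Fin 2) : Plane := EuclideanSpace.single i 1

theorem clm_apply_eq_sum_planeBasis {F : Type*} [NormedAddCommGroup F] [NormedSpace ℝ F]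
    (L : Plane →L[ℝ] F) (v : Plane) : L v = v 0 • L (planeBasis 0) + v 1 • L (planeBasis 1) := by
  rw [← map_smul, ← map_smul, ← map_add]
  congr 1
  ext i
  fin_cases i <;> simp [planeBasis]

theorem inner_plane (v w : Plane) : inner ℝ v w = v 0 * w 0 + v 1 * w 1 := by
  simp [PiLp.inner_apply, Fin.sum_univ_two, mul_comm]

theorem norm_sq_plane (v : Plane) : ‖v‖ ^ 2 = v 0 ^ 2 + v 1 ^ 2 := by
  simp [EuclideanSpace.real_norm_sq_eq, Fin.sum_univ_two]

/-! ### Integration by parts in the plane -/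

section IntegrationByParts

variable {A B W : Plane → Plane} {v : Plane}

theorem DiskSupported.fderiv_apply (hA : DiskSupported A) (v : Plane) :
    DiskSupported fun y => _root_.fderiv ℝ A y v := fun y hy => by
  simp [hA.fderiv y hy]

/-- Support is required of `A` only, since `B` will be the periodic lift of a test field. -/
theorem integral_inner_fderiv_eq_neg (hA : ContDiff ℝ 1 A) (hB : ContDiff ℝ 1 B)
    (hs : DiskSupported A) :
    ∫ y, inner ℝ (A y) (fderiv ℝ B y v) = -∫ y, inner ℝ (fderiv ℝ A y v) (B y) := by
  have cA := hA.continuous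
  have cB := hB.continuous
  have cA' : Continuous fun y => fderiv ℝ A y v :=
    (hA.continuous_fderiv one_ne_zero).clm_apply continuous_const
  have cB' : Continuous fun y => fderiv ℝ B y v :=
    (hB.continuous_fderiv one_ne_zero).clm_apply continuous_const
  refine integral_bilinear_fderiv_right_eq_neg_left_of_integrable (B := innerSL ℝ)
    ?_ ?_ ?_ (fun x _ => hA.differentiable one_ne_zero x)
    (fun x _ => hB.differentiable one_ne_zero x)
  · refine (cA'.inner cB).integrable_of_hasCompactSupport ?_
    exact DiskSupported.hasCompactSupport fun y hy => by simp [hs.fderiv y hy]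
  · refine (cA.inner cB').integrable_of_hasCompactSupport ?_
    exact DiskSupported.hasCompactSupport fun y hy => by simp [hs y hy]
  · refine (cA.inner cB).integrable_of_hasCompactSupport ?_
    exact DiskSupported.hasCompactSupport fun y hy => by simp [hs y hy]

theorem integral_divergence_eq_zero (hW : ContDiff ℝ 1 W) (hs : DiskSupported W) :
    ∫ y, (fderiv ℝ W y (planeBasis 0) 0 + fderiv ℝ W y (planeBasis 1) 1) = 0 := by
  have h : ∀ i, ∫ y, fderiv ℝ W y (planeBasis i) i = 0 := fun i => by
    -- Pairing with a constant field leaves no derivative on the other side.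
    have := integral_inner_fderiv_eq_neg (v := planeBasis i) hW
      (contDiff_const (c := planeBasis i)) hs
    simpa [EuclideanSpace.inner_single_right] using this
  have hi : ∀ i, Integrable fun y => fderiv ℝ W y (planeBasis i) i := fun i => by
    refine Continuous.integrable_of_hasCompactSupport ?_
      (DiskSupported.hasCompactSupport fun y hy => by simp [hs.fderiv y hy])
    exact (PiLp.continuous_apply 2 _ i).comp
      ((hW.continuous_fderiv one_ne_zero).clm_apply continuous_const)
  rw [integral_add (hi 0) (hi 1), h, h, add_zero]

theorem laplacian_plane {F : Type*} [NormedAddCommGroup F] [NormedSpace ℝ F] {f : Plane → F}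
    (hf : ContDiff ℝ 2 f) (y : Plane) :
    Laplacian.laplacian f y = ∑ i, fderiv ℝ (fun z => fderiv ℝ f z (planeBasis i)) y
      (planeBasis i) := by
  rw [InnerProductSpace.laplacian_eq_iteratedFDeriv_orthonormalBasis f
    (EuclideanSpace.basisFun (Fin 2) ℝ)]
  refine Finset.sum_congr rfl fun i _ => ?_
  have hd : DifferentiableAt ℝ (fderiv ℝ f) y :=
    (hf.fderiv_right (m := 1) (by norm_num)).differentiable one_ne_zero y
  rw [iteratedFDeriv_two_apply, fderiv_clm_apply hd (differentiableAt_const _)]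
  simp [planeBasis]

theorem contDiff_fderiv_apply {F : Type*} [NormedAddCommGroup F] [NormedSpace ℝ F]
    {f : Plane → F} (hf : ContDiff ℝ 2 f) (v : Plane) :
    ContDiff ℝ 1 fun z => fderiv ℝ f z v :=
  (hf.fderiv_right (m := 1) (by norm_num)).clm_apply contDiff_const

theorem integral_inner_laplacian (hA : ContDiff ℝ 2 A) (hB : ContDiff ℝ 2 B)
    (hs : DiskSupported A) :
    ∫ y, inner ℝ (A y) (Laplacian.laplacian B y)
      = ∫ y, inner ℝ (Laplacian.laplacian A y) (B y) := by
  have hA1 := hA.of_le (m := 1) (by norm_num)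
  have hB1 := hB.of_le (m := 1) (by norm_num)
  simp only [laplacian_plane hA, laplacian_plane hB, inner_sum, sum_inner]
  have cA : ∀ i, Continuous fun y => fderiv ℝ (fun z => fderiv ℝ A z (planeBasis i)) y
      (planeBasis i) := fun i =>
    ((contDiff_fderiv_apply hA _).continuous_fderiv one_ne_zero).clm_apply continuous_const
  have cB : ∀ i, Continuous fun y => fderiv ℝ (fun z => fderiv ℝ B z (planeBasis i)) y
      (planeBasis i) := fun i =>
    ((contDiff_fderiv_apply hB _).continuous_fderiv one_ne_zero).clm_apply continuous_const
  rw [integral_finsetSum, integral_finsetSum]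
  · refine Finset.sum_congr rfl fun i _ => ?_
    have h := integral_inner_fderiv_eq_neg (v := planeBasis i)
      (contDiff_fderiv_apply hA (planeBasis i)) hB1 (hs.fderiv_apply _)
    rw [integral_inner_fderiv_eq_neg hA1 (contDiff_fderiv_apply hB _) hs, h, neg_neg]
  · intro i _
    refine ((cA i).inner hB.continuous).integrable_of_hasCompactSupport ?_
    exact DiskSupported.hasCompactSupport fun y hy => by
      simp [((hs.fderiv_apply (planeBasis i)).fderiv_apply (planeBasis i)) y hy]
  · intro i _
    refine (hA.continuous.inner (cB i)).integrable_of_hasCompactSupport ?_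
    exact DiskSupported.hasCompactSupport fun y hy => by simp [hs y hy]

end IntegrationByParts

/-! ### Circular flows: divergence, Laplacian and pressure -/

section Swirl

/-- Rotation by a right angle as a continuous linear map. -/
noncomputable def planePerpL : Plane →L[ℝ] Plane :=
  LinearMap.toContinuousLinearMap
    { toFun := planePerp
      map_add' := fun x y => by ext i; fin_cases i <;> simp [planePerp, add_comm]
      map_smul' := fun c x => by ext i; fin_cases i <;> simp [planePerp] }

theorem planePerpL_apply (y : Plane) : planePerpL y = planePerp y := rfl

@[simp] theorem planePerp_zero_apply (y : Plane) : planePerp y 0 = -y 1 := rfl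

@[simp] theorem planePerp_one_apply (y : Plane) : planePerp y 1 = y 0 := rfl

theorem norm_planePerp (y : Plane) : ‖planePerp y‖ = ‖y‖ := by
  have : ‖planePerp y‖ ^ 2 = ‖y‖ ^ 2 := by simp [norm_sq_plane, add_comm]
  exact (sq_eq_sq₀ (norm_nonneg _) (norm_nonneg _)).1 this

/-- The circular flow with squared-radius profile `q`. -/
noncomputable def swirl (q : ℝ → ℝ) (y : Plane) : Plane := q (‖y‖ ^ 2) • planePerp y

/-- Smooth profiles supported in `[1/4, 1]`. -/
structure IsAnnular (q : ℝ → ℝ) : Prop where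
  smooth : ContDiff ℝ ∞ q
  eq_zero : ∀ s, s ∉ Icc (1 / 4) 1 → q s = 0

/-- The profile of the Laplacian of a circular flow. -/
noncomputable def laplaceProfile (q : ℝ → ℝ) (s : ℝ) : ℝ :=
  4 * s * deriv (deriv q) s + 8 * deriv q s

variable {q : ℝ → ℝ}

theorem IsAnnular.deriv (hq : IsAnnular q) : IsAnnular (deriv q) where
  smooth := (contDiff_infty_iff_deriv.1 hq.smooth).2
  eq_zero s hs := by
    have : q =ᶠ[𝓝 s] fun _ => 0 := by
      filter_upwards [isClosed_Icc.isOpen_compl.mem_nhds hs] with z hz using hq.eq_zero z hz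
    rw [this.deriv_eq, deriv_const]

theorem IsAnnular.laplaceProfile (hq : IsAnnular q) : IsAnnular (laplaceProfile q) where
  smooth := ((contDiff_const.mul contDiff_id).mul hq.deriv.deriv.smooth).add
    (contDiff_const.mul hq.deriv.smooth)
  eq_zero s hs := by
    simp [_root_.laplaceProfile, hq.deriv.eq_zero s hs, hq.deriv.deriv.eq_zero s hs]

theorem IsAnnular.diskSupported_comp (hq : IsAnnular q) :
    DiskSupported fun y => q (‖y‖ ^ 2) := fun y hy =>
  hq.eq_zero _ fun h => by nlinarith [h.2]

theorem IsAnnular.diskSupported_swirl (hq : IsAnnular q) : DiskSupported (swirl q) :=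
  fun y hy => by
    have := hq.diskSupported_comp y hy
    simp_all [swirl]

/-- Profiles are functions of the squared radius because `‖y‖²`, unlike `‖y‖`, is smooth at the
origin. -/
theorem contDiff_swirl (hq : ContDiff ℝ ∞ q) : ContDiff ℝ ∞ (swirl q) :=
  (hq.comp (contDiff_norm_sq ℝ)).smul planePerpL.contDiff

theorem hasFDerivAt_comp_norm_sq {a : ℝ} {y : Plane} (hq : HasDerivAt q a (‖y‖ ^ 2)) :
    HasFDerivAt (fun z : Plane => q (‖z‖ ^ 2)) ((2 * a) • innerSL ℝ y) y := by
  have := hq.comp_hasFDerivAt y (hasStrictFDerivAt_norm_sq y).hasFDerivAt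
  have e : (2 * a) • innerSL ℝ y = a • 2 • innerSL ℝ y := by
    ext v
    simp
    ring
  rw [e]
  exact this

theorem fderiv_swirl (hq : Differentiable ℝ q) (y v : Plane) :
    fderiv ℝ (swirl q) y v =
      q (‖y‖ ^ 2) • planePerp v + (2 * deriv q (‖y‖ ^ 2) * inner ℝ y v) • planePerp y := by
  have := (hasFDerivAt_comp_norm_sq (hq (‖y‖ ^ 2)).hasDerivAt).smul
    (planePerpL.hasFDerivAt (x := y))
  have h2 : fderiv ℝ (swirl q) y = _ := HasFDerivAt.fderiv this
  rw [h2]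
  simp [planePerpL_apply]

/-- With `s = ‖y‖²`, the Laplacian of the scalar `q(s)` in dimension two is `4 s q'' + 4 q'`, the
cross term `2 ∇q(s) · ∇y^⊥` adds `4 q' y^⊥`, and `y^⊥` is harmonic. -/
theorem laplacian_swirl (hq : ContDiff ℝ ∞ q) (y : Plane) :
    Laplacian.laplacian (swirl q) y = swirl (laplaceProfile q) y := by
  have hd : Differentiable ℝ q := hq.differentiable (by simp)
  have hd' : Differentiable ℝ (deriv q) :=
    (contDiff_infty_iff_deriv.1 hq).2.differentiable (by simp)
  rw [laplacian_plane (contDiff_infty.1 (contDiff_swirl hq) 2)]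
  simp only [fderiv_swirl hd]
  have key : ∀ e : Plane, fderiv ℝ (fun z : Plane => q (‖z‖ ^ 2) • planePerp e
      + (2 * deriv q (‖z‖ ^ 2) * inner ℝ z e) • planePerp z) y e =
      (2 * deriv q (‖y‖ ^ 2) * inner ℝ y e) • planePerp e +
      ((2 * deriv q (‖y‖ ^ 2) * inner ℝ y e) • planePerp e +
       (2 * deriv q (‖y‖ ^ 2) * inner ℝ e e +
        4 * deriv (deriv q) (‖y‖ ^ 2) * inner ℝ y e * inner ℝ y e) • planePerp y) := by
    intro e
    have h1 := (hasFDerivAt_comp_norm_sq (hd (‖y‖ ^ 2)).hasDerivAt).smul_const (planePerp e)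
    have h2 := ((hasFDerivAt_comp_norm_sq (hd' (‖y‖ ^ 2)).hasDerivAt).const_mul 2).mul
      ((innerSL ℝ e).hasFDerivAt (x := y))
    have h3 := h1.add (h2.smul (planePerpL.hasFDerivAt (x := y)))
    have h4 : (fun z : Plane => q (‖z‖ ^ 2) • planePerp e
      + (2 * deriv q (‖z‖ ^ 2) * inner ℝ z e) • planePerp z) =
      (fun z : Plane => q (‖z‖ ^ 2) • planePerp e
      + (2 * deriv q (‖z‖ ^ 2) * innerSL ℝ e z) • planePerpL z) := by
      funext z; simp [planePerpL_apply, real_inner_comm]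
    rw [h4]
    erw [h3.fderiv]
    simp [planePerpL_apply, real_inner_comm y e]
    module
  rw [Fin.sum_univ_two, key, key]
  ext i
  fin_cases i <;>
  · simp [swirl, laplaceProfile, inner_plane, norm_sq_plane, planeBasis]
    ring

/-- The gradient of the profile is radial, hence orthogonal to `y^⊥`, so `div (ψ G) = ∇ψ · G` for
the circular flow `G`. -/
theorem integral_fderiv_swirl_eq_zero (hq : IsAnnular q) {ψ : Plane → ℝ}
    (hψ : ContDiff ℝ 1 ψ) : ∫ y, fderiv ℝ ψ y (swirl q y) = 0 := by
  have hG : ContDiff ℝ 1 (swirl q) := (contDiff_swirl hq.smooth).of_le (by exact_mod_cast le_top)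
  have h := integral_divergence_eq_zero (W := fun y => ψ y • swirl q y) (hψ.smul hG)
    fun y hy => by simp [hq.diskSupported_swirl y hy]
  rw [← h]
  congr 1
  funext y
  have e : ∀ v, fderiv ℝ (fun y => ψ y • swirl q y) y v =
      ψ y • fderiv ℝ (swirl q) y v + fderiv ℝ ψ y v • swirl q y := fun v => by
    rw [fderiv_fun_smul (hψ.differentiable one_ne_zero y) (hG.differentiable one_ne_zero y)]
    simp
  rw [e, e, fderiv_swirl (hq.smooth.differentiable (by simp)),
    fderiv_swirl (hq.smooth.differentiable (by simp)), clm_apply_eq_sum_planeBasis]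
  simp [swirl, inner_plane, planeBasis]
  ring

/-- The pressure balancing the centrifugal force: `(G·∇)G = -q² y`, while the gradient of `p(‖y‖²)`
is `2 p' y`. Integrating from `1` makes the pressure vanish outside the disk. -/
theorem IsAnnular.exists_pressure (hq : IsAnnular q) : ∃ p : ℝ → ℝ,
    (∀ s, HasDerivAt p (q s ^ 2 / 2) s) ∧ ∀ s, 1 < s → p s = 0 := by
  have hc : Continuous fun s => q s ^ 2 / 2 := (hq.smooth.continuous.pow 2).div_const 2
  refine ⟨fun s => ∫ x in (1 : ℝ)..s, q x ^ 2 / 2, fun s => ?_, fun s hs => ?_⟩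
  · exact intervalIntegral.integral_hasDerivAt_right (hc.intervalIntegrable _ _)
      hc.aestronglyMeasurable.stronglyMeasurableAtFilter hc.continuousAt
  · refine intervalIntegral.integral_zero_ae (ae_of_all _ fun x hx => ?_)
    rw [uIoc_of_le hs.le] at hx
    rw [hq.eq_zero x fun h => absurd h.2 (not_le.2 hx.1)]
    norm_num

/-- With `P(y) = p(‖y‖²)`, the divergence of `(G·ψ) G + P ψ` is `G · Dψ G + ((G·∇)G + ∇P) · ψ + P
div ψ`, in which only the first term survives. Because `P` vanishes outside the disk, `div ψ = 0` is
needed only inside it. -/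
theorem integral_convection_swirl_eq_zero (hq : IsAnnular q) {ψ : Plane → Plane}
    (hψ : ContDiff ℝ 1 ψ)
    (hdiv : ∀ y, ‖y‖ ≤ 1 →
      fderiv ℝ ψ y (planeBasis 0) 0 + fderiv ℝ ψ y (planeBasis 1) 1 = 0) :
    ∫ y, inner ℝ (swirl q y) (fderiv ℝ ψ y (swirl q y)) = 0 := by
  obtain ⟨p, hp, hp0⟩ := hq.exists_pressure
  have hqd : Differentiable ℝ q := hq.smooth.differentiable (by simp)
  have hG : ContDiff ℝ 1 (swirl q) := (contDiff_swirl hq.smooth).of_le (by exact_mod_cast le_top)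
  have hpC : ContDiff ℝ 1 p := by
    rw [contDiff_one_iff_deriv]
    refine ⟨fun s => (hp s).differentiableAt, ?_⟩
    rw [show deriv p = fun s => q s ^ 2 / 2 from funext fun s => (hp s).deriv]
    exact (hq.smooth.continuous.pow 2).div_const 2
  have hP : ContDiff ℝ 1 fun y : Plane => p (‖y‖ ^ 2) := hpC.comp (contDiff_norm_sq ℝ)
  have hI : ContDiff ℝ 1 fun y => inner ℝ (swirl q y) (ψ y) := hG.inner ℝ hψ
  have h := integral_divergence_eq_zero
    (W := fun y => (inner ℝ (swirl q y) (ψ y) : ℝ) • swirl q y + p (‖y‖ ^ 2) • ψ y)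
    ((hI.smul hG).add (hP.smul hψ))
    fun y hy => by
      simp [hq.diskSupported_swirl y hy, hp0 (‖y‖ ^ 2) (by nlinarith)]
  rw [← h]
  congr 1
  funext y
  have dψ := hψ.differentiable one_ne_zero y
  have dG := hG.differentiable one_ne_zero y
  have e : ∀ v, fderiv ℝ (fun y => (inner ℝ (swirl q y) (ψ y) : ℝ) • swirl q y
        + p (‖y‖ ^ 2) • ψ y) y v =
      (inner ℝ (swirl q y) (ψ y) : ℝ) • fderiv ℝ (swirl q) y v
      + (inner ℝ (swirl q y) (fderiv ℝ ψ y v) + inner ℝ (fderiv ℝ (swirl q) y v) (ψ y)) • swirl q y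
      + (p (‖y‖ ^ 2) • fderiv ℝ ψ y v + (q (‖y‖ ^ 2) ^ 2 * inner ℝ y v) • ψ y) := fun v => by
    rw [fderiv_fun_add ((dG.inner ℝ dψ).fun_smul dG)
      ((hP.differentiable one_ne_zero y).fun_smul dψ),
      fderiv_fun_smul (dG.inner ℝ dψ) dG,
      fderiv_fun_smul (hP.differentiable one_ne_zero y) dψ,
      (hasFDerivAt_comp_norm_sq (hp _)).fderiv]
    simp [fderiv_inner_apply ℝ dG dψ]
    rw [show 2 * (q (‖y‖ ^ 2) ^ 2 / 2) = q (‖y‖ ^ 2) ^ 2 by ring]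
  rw [e, e, fderiv_swirl hqd, fderiv_swirl hqd, clm_apply_eq_sum_planeBasis]
  have h0 : p (‖y‖ ^ 2) *
      (fderiv ℝ ψ y (planeBasis 0) 0 + fderiv ℝ ψ y (planeBasis 1) 1) = 0 := by
    rcases le_or_gt ‖y‖ 1 with hy | hy
    · rw [hdiv y hy, mul_zero]
    · rw [hp0 _ (by nlinarith), zero_mul]
  simp only [planeBasis] at h0
  simp [swirl, inner_plane, planeBasis]
  linear_combination -h0

end Swirl

/-! ### Integrals of total time derivatives -/

section Time

theorem integral_time_deriv_eq_zero {g : ℝ × Plane → ℝ} (hg : ContDiff ℝ 1 g)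
    (hc : HasCompactSupport g) :
    Integrable (fun t : ℝ => ∫ y, fderiv ℝ g (t, y) (1, 0)) ∧
      ∫ t : ℝ, ∫ y, fderiv ℝ g (t, y) (1, 0) = 0 := by
  have hi : Integrable (fun z : ℝ × Plane => fderiv ℝ g z (1, 0)) (volume.prod volume) := by
    refine Continuous.integrable_of_hasCompactSupport
      ((hg.continuous_fderiv one_ne_zero).clm_apply continuous_const) ?_
    exact hc.fderiv_apply ℝ _
  refine ⟨hi.integral_prod_left, ?_⟩
  rw [← integral_prod (fun z : ℝ × Plane => fderiv ℝ g z (1, 0)) hi]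
  have := integral_mul_fderiv_eq_neg_fderiv_mul_of_integrable 
    (μ := (volume : Measure ℝ).prod (volume : Measure Plane))
    (f := fun _ => (1 : ℝ)) (g := g) (v := (1, 0)) (by simp) (by simpa only [one_mul] using hi)
    (by simpa only [one_mul] using hg.continuous.integrable_of_hasCompactSupport (μ := volume.prod volume) hc)
    (fun x _ => differentiableAt_const _) (fun x _ => hg.differentiable one_ne_zero x)
  simpa using this

end Time

/-! ### Oscillating profiles and the cost of differentiating them -/

section Profiles

/-- Vanishing below `1/4` makes smoothness at `s ≤ 0` automatic, so `√s` and `1/s` may enter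
profiles freely. -/
theorem isAnnular_of_contDiffAt {g : ℝ → ℝ} (h : ∀ s, 0 < s → ContDiffAt ℝ ∞ g s)
    (h0 : ∀ s, s ∉ Icc (1 / 4) 1 → g s = 0) : IsAnnular g where
  smooth := by
    rw [contDiff_iff_contDiffAt]
    intro s
    rcases lt_or_ge 0 s with hs | hs
    · exact h s hs
    · have : g =ᶠ[𝓝 s] fun _ => 0 := by
        filter_upwards [gt_mem_nhds (show s < 1 / 4 by linarith)] with z hz
        exact h0 z fun h => by linarith [h.1]
      exact contDiffAt_const.congr_of_eventuallyEq this
  eq_zero := h0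

theorem IsAnnular.mul_left {a g : ℝ → ℝ} (ha : IsAnnular a)
    (h : ∀ s, 0 < s → ContDiffAt ℝ ∞ g s) : IsAnnular fun s => g s * a s :=
  isAnnular_of_contDiffAt (fun s hs => (h s hs).mul ha.smooth.contDiffAt)
    fun s hs => by rw [ha.eq_zero s hs, mul_zero]

theorem IsAnnular.exists_bound {a : ℝ → ℝ} (ha : IsAnnular a) : ∃ C, ∀ s, |a s| ≤ C :=
  ha.smooth.continuous.bounded_above_of_compact_support
    (HasCompactSupport.intro isCompact_Icc ha.eq_zero)

/-- At `s = ‖y‖²` the phase is `κ ‖y‖`; `κ` will be `ν^(-1/3)`. -/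
noncomputable def sinProfile (κ : ℝ) (a : ℝ → ℝ) (s : ℝ) : ℝ := Real.sin (κ * √s) * a s

noncomputable def cosProfile (κ : ℝ) (a : ℝ → ℝ) (s : ℝ) : ℝ := Real.cos (κ * √s) * a s

/-- The factor produced by differentiating the phase `√s`. -/
noncomputable def phaseDeriv (a : ℝ → ℝ) (s : ℝ) : ℝ := (2 * √s)⁻¹ * a s

variable {a : ℝ → ℝ} (κ : ℝ)

theorem IsAnnular.sinProfile (ha : IsAnnular a) : IsAnnular (sinProfile κ a) :=
  ha.mul_left fun _ hs => (contDiffAt_const.mul (Real.contDiffAt_sqrt hs.ne')).sin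

theorem IsAnnular.cosProfile (ha : IsAnnular a) : IsAnnular (cosProfile κ a) :=
  ha.mul_left fun _ hs => (contDiffAt_const.mul (Real.contDiffAt_sqrt hs.ne')).cos

theorem IsAnnular.phaseDeriv (ha : IsAnnular a) : IsAnnular (phaseDeriv a) :=
  ha.mul_left fun _ hs => (contDiffAt_const.mul (Real.contDiffAt_sqrt hs.ne')).inv
    (by positivity)

theorem abs_sinProfile_le (s : ℝ) : |sinProfile κ a s| ≤ |a s| := by
  rw [sinProfile, abs_mul]
  exact mul_le_of_le_one_left (abs_nonneg _) (Real.abs_sin_le_one _)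

theorem abs_cosProfile_le (s : ℝ) : |cosProfile κ a s| ≤ |a s| := by
  rw [cosProfile, abs_mul]
  exact mul_le_of_le_one_left (abs_nonneg _) (Real.abs_cos_le_one _)

theorem hasDerivAt_phase {s : ℝ} (hs : 0 < s) :
    HasDerivAt (fun s => κ * √s) (κ * (2 * √s)⁻¹) s := by
  simpa using (Real.hasDerivAt_sqrt hs.ne').const_mul κ

/-- Sine and cosine profiles are closed under differentiation: each derivative costs at most one
factor `κ`, and the new amplitudes do not depend on `κ`. -/
theorem IsAnnular.deriv_sinProfile (ha : IsAnnular a) :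
    _root_.deriv (_root_.sinProfile κ a) = fun s =>
      κ * _root_.cosProfile κ (_root_.phaseDeriv a) s
        + _root_.sinProfile κ (_root_.deriv a) s := by
  funext s
  by_cases hs : s ∈ Icc (1 / 4 : ℝ) 1
  · have hd := (ha.smooth.differentiable (by simp) s).hasDerivAt
    have h := (hasDerivAt_phase κ (show 0 < s by linarith [hs.1])).sin.mul hd
    refine h.deriv.trans ?_
    simp only [_root_.cosProfile, _root_.phaseDeriv, _root_.sinProfile]
    ring
  · rw [(ha.sinProfile κ).deriv.eq_zero s hs, (ha.phaseDeriv.cosProfile κ).eq_zero s hs,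
      (ha.deriv.sinProfile κ).eq_zero s hs]
    ring

theorem IsAnnular.deriv_cosProfile (ha : IsAnnular a) :
    _root_.deriv (_root_.cosProfile κ a) = fun s =>
      -κ * _root_.sinProfile κ (_root_.phaseDeriv a) s
        + _root_.cosProfile κ (_root_.deriv a) s := by
  funext s
  by_cases hs : s ∈ Icc (1 / 4 : ℝ) 1
  · have hd := (ha.smooth.differentiable (by simp) s).hasDerivAt
    have h := (hasDerivAt_phase κ (show 0 < s by linarith [hs.1])).cos.mul hd
    refine h.deriv.trans ?_
    simp only [_root_.cosProfile, _root_.phaseDeriv, _root_.sinProfile]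
    ring
  · rw [(ha.cosProfile κ).deriv.eq_zero s hs, (ha.phaseDeriv.sinProfile κ).eq_zero s hs,
      (ha.deriv.cosProfile κ).eq_zero s hs]
    ring

/-- Two derivatives yield a polynomial of degree two in `κ` whose coefficients are bounded uniformly
in `κ` and `s`. -/
theorem IsAnnular.exists_laplaceProfile_bound (ha : IsAnnular a) :
    ∃ C, ∀ κ, 0 ≤ κ → ∀ s, |_root_.laplaceProfile (_root_.sinProfile κ a) s|
      ≤ C * (1 + κ) ^ 2 := by
  obtain ⟨C₁, h₁⟩ := ha.phaseDeriv.phaseDeriv.exists_bound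
  obtain ⟨C₂, h₂⟩ := ha.phaseDeriv.deriv.exists_bound
  obtain ⟨C₃, h₃⟩ := ha.deriv.phaseDeriv.exists_bound
  obtain ⟨C₄, h₄⟩ := ha.deriv.deriv.exists_bound
  obtain ⟨C₅, h₅⟩ := ha.phaseDeriv.exists_bound
  obtain ⟨C₆, h₆⟩ := ha.deriv.exists_bound
  have p₁ := (abs_nonneg _).trans (h₁ 0)
  have p₂ := (abs_nonneg _).trans (h₂ 0)
  have p₃ := (abs_nonneg _).trans (h₃ 0)
  have p₄ := (abs_nonneg _).trans (h₄ 0)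
  have p₅ := (abs_nonneg _).trans (h₅ 0)
  have p₆ := (abs_nonneg _).trans (h₆ 0)
  -- The factors `4` and `8` are those of `laplaceProfile`, with `s ≤ 1` on the support; `C₁` to
  -- `C₄` bound the second derivative, `C₅` and `C₆` the first.
  refine ⟨4 * (C₁ + C₂ + C₃ + C₄) + 8 * (C₅ + C₆), fun κ hκ s => ?_⟩
  by_cases hs : s ∈ Icc (1 / 4 : ℝ) 1
  · have hd1 := ha.deriv_sinProfile κ
    have hd2 : _root_.deriv (_root_.deriv (_root_.sinProfile κ a)) s =
        κ * (-κ * _root_.sinProfile κ (_root_.phaseDeriv (_root_.phaseDeriv a)) s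
          + _root_.cosProfile κ (_root_.deriv (_root_.phaseDeriv a)) s)
        + (κ * _root_.cosProfile κ (_root_.phaseDeriv (_root_.deriv a)) s
          + _root_.sinProfile κ (_root_.deriv (_root_.deriv a)) s) := by
      have d1 := (ha.phaseDeriv.cosProfile κ).smooth.differentiable (by simp) s
      have d2 := (ha.deriv.sinProfile κ).smooth.differentiable (by simp) s
      rw [hd1, deriv_fun_add (d1.const_mul κ) d2, deriv_const_mul _ d1,
        ha.phaseDeriv.deriv_cosProfile, ha.deriv.deriv_sinProfile]
    rw [_root_.laplaceProfile, hd2, congrFun hd1 s]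
    have b₁ := abs_le.1 ((abs_sinProfile_le κ s).trans (h₁ s))
    have b₂ := abs_le.1 ((abs_cosProfile_le κ s).trans (h₂ s))
    have b₃ := abs_le.1 ((abs_cosProfile_le κ s).trans (h₃ s))
    have b₄ := abs_le.1 ((abs_sinProfile_le κ s).trans (h₄ s))
    have b₅ := abs_le.1 ((abs_cosProfile_le κ s).trans (h₅ s))
    have b₆ := abs_le.1 ((abs_sinProfile_le κ s).trans (h₆ s))
    generalize _root_.sinProfile κ (_root_.phaseDeriv (_root_.phaseDeriv a)) s = x₁ at *
    generalize _root_.cosProfile κ (_root_.deriv (_root_.phaseDeriv a)) s = x₂ at *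
    generalize _root_.cosProfile κ (_root_.phaseDeriv (_root_.deriv a)) s = x₃ at *
    generalize _root_.sinProfile κ (_root_.deriv (_root_.deriv a)) s = x₄ at *
    generalize _root_.cosProfile κ (_root_.phaseDeriv a) s = x₅ at *
    generalize _root_.sinProfile κ (_root_.deriv a) s = x₆ at *
    have hX : |κ * (-κ * x₁ + x₂) + (κ * x₃ + x₄)| ≤ (C₁ + C₂ + C₃ + C₄) * (1 + κ) ^ 2 := by
      have q1 : |κ ^ 2 * x₁| ≤ C₁ * κ ^ 2 := by
        rw [abs_mul, abs_of_nonneg (by positivity), mul_comm]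
        exact mul_le_mul_of_nonneg_right (abs_le.2 b₁) (by positivity)
      have q2 : |κ * x₂| ≤ C₂ * κ := by
        rw [abs_mul, abs_of_nonneg hκ, mul_comm]
        exact mul_le_mul_of_nonneg_right (abs_le.2 b₂) hκ
      have q3 : |κ * x₃| ≤ C₃ * κ := by
        rw [abs_mul, abs_of_nonneg hκ, mul_comm]
        exact mul_le_mul_of_nonneg_right (abs_le.2 b₃) hκ
      rw [abs_le] at *
      have r1 := mul_nonneg p₁ hκ
      have r2 := mul_nonneg p₂ hκ
      have r3 := mul_nonneg p₃ hκ
      have r4 := mul_nonneg p₄ hκ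
      have r2' := mul_nonneg r2 hκ
      have r3' := mul_nonneg r3 hκ
      have r4' := mul_nonneg r4 hκ
      constructor <;> nlinarith
    have hY : |κ * x₅ + x₆| ≤ (C₅ + C₆) * (1 + κ) ^ 2 := by
      have q1 : |κ * x₅| ≤ C₅ * κ := by
        rw [abs_mul, abs_of_nonneg hκ, mul_comm]
        exact mul_le_mul_of_nonneg_right (abs_le.2 b₅) hκ
      rw [abs_le] at *
      have r1 := mul_nonneg p₅ hκ
      have r2 := mul_nonneg p₆ hκ
      have r1' := mul_nonneg r1 hκ
      have r2' := mul_nonneg r2 hκ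
      constructor <;> nlinarith
    generalize κ * (-κ * x₁ + x₂) + (κ * x₃ + x₄) = X at *
    generalize κ * x₅ + x₆ = Y at *
    clear hd2
    calc |4 * s * X + 8 * Y| ≤ |4 * s * X| + |8 * Y| := abs_add_le _ _
      _ = 4 * s * |X| + 8 * |Y| := by
          rw [abs_mul (4 * s), abs_mul 8, abs_of_nonneg (by linarith [hs.1] : 0 ≤ 4 * s),
            abs_of_nonneg (by norm_num : (0 : ℝ) ≤ 8)]
      _ ≤ 4 * |X| + 8 * |Y| := by
          have := mul_le_mul_of_nonneg_right hs.2 (abs_nonneg X)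
          linarith
      _ ≤ _ := by linarith
  · rw [(ha.sinProfile κ).laplaceProfile.eq_zero s hs, abs_zero]
    positivity

end Profiles

/-! ### Riemann–Lebesgue lemma for radial phases -/

section RiemannLebesgue

/-- The Riemann-Lebesgue lemma for radial oscillations in the plane. -/
theorem tendsto_integral_exp_norm_smul (g : Plane → ℂ) :
    Tendsto (fun κ : ℝ => ∫ y, Complex.exp ((κ * ‖y‖ : ℝ) * Complex.I) * g y) atTop (𝓝 0) := by
  let Φ : ℂ ≃ₗᵢ[ℝ] Plane := Complex.orthonormalBasisOneI.repr
  -- In polar coordinates, with the Jacobian absorbed into `h`, the phase depends on the first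
  -- variable alone. The integral is thus a Fourier integral of `h` at the frequency `κ • L`, which
  -- leaves every compact set as `κ → ∞`; the constant in `L` undoes the `-2π` of the Fourier
  -- character.
  let h : ℝ × ℝ → ℂ := polarCoord.target.indicator fun p =>
    p.1 • g (Φ (Complex.polarCoord.symm p))
  let L : StrongDual ℝ (ℝ × ℝ) := (-(2 * Real.pi)⁻¹) • ContinuousLinearMap.fst ℝ ℝ ℝ
  have hL : L ≠ 0 := fun h0 => by
    have := congrArg (fun l : StrongDual ℝ (ℝ × ℝ) => l (1, 0)) h0
    simp [L, Real.pi_ne_zero] at this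
  have key := (tendsto_integral_exp_smul_cocompact h
    ((volume : Measure ℝ).prod (volume : Measure ℝ))).comp
    (((isClosedEmbedding_smul_left hL).tendsto_cocompact).mono_left (atTop_le_cocompact (α := ℝ)))
  refine key.congr fun κ => ?_
  rw [← (LinearIsometryEquiv.measurePreserving Φ).integral_comp
      Φ.toHomeomorph.measurableEmbedding,
    ← Complex.integral_comp_polarCoord_symm, ← integral_indicator polarCoord.open_target.measurableSet]
  refine integral_congr_ae (ae_of_all _ fun p => ?_)
  by_cases hp : p ∈ polarCoord.target
  · have hp1 : 0 < p.1 := by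
      rw [polarCoord_target] at hp
      exact hp.1
    have e : Real.fourierChar (-(κ • L) p) = Complex.exp ((κ * p.1 : ℝ) * Complex.I) := by
      rw [Real.fourierChar_apply]
      congr 1
      simp only [L]
      push_cast
      simp
      field_simp
    simp only [h, indicator_of_mem hp, Circle.smul_def, e]
    rw [LinearIsometryEquiv.norm_map, Complex.norm_polarCoord_symm, abs_of_pos hp1]
    simp
    ring
  · simp only [h, indicator_of_notMem hp, smul_zero]

theorem integrable_exp_norm_mul {g : Plane → ℝ} (hg : Integrable g) (κ : ℝ) :
    Integrable fun y => Complex.exp ((κ * ‖y‖ : ℝ) * Complex.I) * (g y : ℂ) := by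
  refine hg.ofReal.bdd_mul (c := 1) (by fun_prop) (ae_of_all _ fun y => ?_)
  rw [Complex.norm_exp_ofReal_mul_I]

theorem tendsto_integral_sin_norm_mul {g : Plane → ℝ} (hg : Integrable g) :
    Tendsto (fun κ : ℝ => ∫ y, Real.sin (κ * ‖y‖) * g y) atTop (𝓝 0) := by
  have h := (Complex.continuous_im.tendsto 0).comp
    (tendsto_integral_exp_norm_smul fun y => (g y : ℂ))
  refine h.congr fun κ => ?_
  have := integral_im (integrable_exp_norm_mul hg κ)
  refine this.symm.trans (integral_congr_ae (ae_of_all _ fun y => ?_))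
  simp [Complex.exp_ofReal_mul_I_im, Complex.exp_ofReal_mul_I_re, -Complex.ofReal_mul]

theorem tendsto_integral_cos_norm_mul {g : Plane → ℝ} (hg : Integrable g) :
    Tendsto (fun κ : ℝ => ∫ y, Real.cos (κ * ‖y‖) * g y) atTop (𝓝 0) := by
  have h := (Complex.continuous_re.tendsto 0).comp
    (tendsto_integral_exp_norm_smul fun y => (g y : ℂ))
  refine h.congr fun κ => ?_
  have := integral_re (integrable_exp_norm_mul hg κ)
  refine this.symm.trans (integral_congr_ae (ae_of_all _ fun y => ?_))
  simp [Complex.exp_ofReal_mul_I_im, Complex.exp_ofReal_mul_I_re, -Complex.ofReal_mul]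

end RiemannLebesgue

/-! ### Weak limit and limiting energy of the oscillating fields -/

section Fields

/-- The vector field on the torus given by a continuous field supported in the unit disk. -/
noncomputable def diskField (K : Plane → Plane) (hc : Continuous K) (hs : DiskSupported K) :
    L2Field :=
  (memLp_comp_torusRep hc hs 2).toLp _

theorem coeFn_diskField {K : Plane → Plane} (hc : Continuous K) (hs : DiskSupported K) :
    diskField K hc hs =ᵐ[volume] fun x => K (torusRep x) :=
  MemLp.coeFn_toLp _

theorem norm_diskField_le {K : Plane → Plane} (hc : Continuous K) (hs : DiskSupported K) {C : ℝ}
    (hC : ∀ y, ‖K y‖ ≤ C) :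
    ‖diskField K hc hs‖ ≤
      (measureUnivNNReal (volume : Measure FlatTorus)) ^ (2 : ℝ≥0∞).toReal⁻¹ * C := by
  refine Lp.norm_le_of_ae_bound ((norm_nonneg _).trans (hC 0)) ?_
  filter_upwards [coeFn_diskField hc hs] with x hx
  rw [hx]
  exact hC _

variable {q a : ℝ → ℝ}

/-- A circular flow as a vector field on the torus. -/
noncomputable def IsAnnular.field (hq : IsAnnular q) : L2Field :=
  diskField (swirl q) (contDiff_swirl hq.smooth).continuous hq.diskSupported_swirl

theorem IsAnnular.coeFn_field (hq : IsAnnular q) :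
    hq.field =ᵐ[volume] fun x => swirl q (torusRep x) :=
  coeFn_diskField _ _

theorem IsAnnular.norm_swirl_le (hq : IsAnnular q) {C : ℝ} (hC : ∀ s, |q s| ≤ C) (y : Plane) :
    ‖swirl q y‖ ≤ C := by
  by_cases hy : 1 < ‖y‖
  · rw [hq.diskSupported_swirl y hy, norm_zero]
    exact (abs_nonneg _).trans (hC 0)
  · rw [swirl, norm_smul, norm_planePerp, Real.norm_eq_abs]
    push Not at hy
    exact (mul_le_of_le_one_right (abs_nonneg _) hy).trans (hC _)

theorem IsAnnular.norm_field_sq (hq : IsAnnular q) :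
    ‖hq.field‖ ^ 2 = ∫ y : Plane, q (‖y‖ ^ 2) ^ 2 * ‖y‖ ^ 2 := by
  rw [← real_inner_self_eq_norm_sq, L2.inner_def, ← integral_comp_torusRep]
  · refine integral_congr_ae ?_
    filter_upwards [hq.coeFn_field] with x hx
    rw [hx, real_inner_self_eq_norm_sq, swirl, norm_smul, norm_planePerp, mul_pow,
      Real.norm_eq_abs, sq_abs]
  · intro y hy
    have := hq.diskSupported_comp y hy
    simp_all

theorem sinProfile_norm_sq (κ : ℝ) (y : Plane) :
    sinProfile κ a (‖y‖ ^ 2) = Real.sin (κ * ‖y‖) * a (‖y‖ ^ 2) := by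
  rw [sinProfile, Real.sqrt_sq (norm_nonneg y)]

/-- The pairing is the integral of `sin (κ ‖y‖)` against a fixed integrable function, the pairing
density of the envelope with `V`. -/
theorem IsAnnular.tendsto_inner_field (ha : IsAnnular a) (V : L2Field) :
    Tendsto (fun κ : ℝ => inner ℝ (ha.sinProfile κ).field V) atTop (𝓝 0) := by
  let g : Plane → ℝ := fun y => inner ℝ (swirl a y) (V (torusProj y))
  have hg : DiskSupported g := fun y hy => by simp [g, ha.diskSupported_swirl y hy]
  have hgi : Integrable g := by
    rw [← integrable_comp_torusRep hg]
    refine (L2.integrable_inner (𝕜 := ℝ) ha.field V).congr ?_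
    filter_upwards [ha.coeFn_field] with x hx
    simp only [g]
    rw [hx, torusProj_torusRep]
  refine (tendsto_integral_sin_norm_mul hgi).congr fun κ => ?_
  rw [L2.inner_def, ← integral_comp_torusRep fun y hy => by simp [hg y hy]]
  refine integral_congr_ae ?_
  filter_upwards [(ha.sinProfile κ).coeFn_field] with x hx
  simp only [g]
  rw [hx, torusProj_torusRep, swirl, swirl, sinProfile_norm_sq, mul_smul,
    real_inner_smul_left _ _ (Real.sin _)]

/-- Since `sin² = (1 - cos 2·)/2`, the energy is half that of the envelope minus a cosine integral
of frequency `2κ`, which tends to zero. -/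
theorem IsAnnular.tendsto_norm_field (ha : IsAnnular a) :
    Tendsto (fun κ : ℝ => ‖(ha.sinProfile κ).field‖ ^ 2) atTop
      (𝓝 ((1 / 2) * ∫ y : Plane, a (‖y‖ ^ 2) ^ 2 * ‖y‖ ^ 2)) := by
  let b : Plane → ℝ := fun y => a (‖y‖ ^ 2) ^ 2 * ‖y‖ ^ 2
  have hb : Integrable b := by
    refine Continuous.integrable_of_hasCompactSupport ?_
      (DiskSupported.hasCompactSupport fun y hy => ?_)
    · exact ((ha.smooth.continuous.comp (by fun_prop)).pow 2).mul (by fun_prop)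
    · have := ha.diskSupported_comp y hy
      simp_all [b]
  have h2 : Tendsto (fun κ : ℝ => 2 * κ) atTop atTop :=
    tendsto_id.const_mul_atTop (by norm_num)
  have h := ((tendsto_integral_cos_norm_mul hb).comp h2).const_mul (1 / 2)
  have h3 := (tendsto_const_nhds (x := (1 / 2) * ∫ y, b y)).sub h
  rw [mul_zero, sub_zero] at h3
  refine h3.congr fun κ => ?_
  have hc : Integrable fun y => Real.cos (2 * κ * ‖y‖) * b y := by
    refine hb.bdd_mul (c := 1) (by fun_prop) (ae_of_all _ fun y => ?_)
    simpa using Real.abs_cos_le_one _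
  rw [(ha.sinProfile κ).norm_field_sq, Function.comp, ← mul_sub, ← integral_sub hb hc,
    ← integral_const_mul]
  congr 1
  funext y
  rw [sinProfile_norm_sq, mul_pow, Real.sin_sq_eq_half_sub]
  simp only [b]
  rw [show 2 * κ * ‖y‖ = 2 * (κ * ‖y‖) by ring]
  ring

theorem IsAnnular.integral_sq_pos (ha : IsAnnular a) (hne : ∃ s, a s ≠ 0) :
    0 < ∫ y : Plane, a (‖y‖ ^ 2) ^ 2 * ‖y‖ ^ 2 := by
  obtain ⟨s, hs⟩ := hne
  have hsm : s ∈ Icc (1 / 4 : ℝ) 1 := by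
    by_contra h
    exact hs (ha.eq_zero s h)
  have hs0 : 0 < s := by linarith [hsm.1]
  refine Continuous.integral_pos_of_hasCompactSupport_nonneg_nonzero
    (x := EuclideanSpace.single 0 (√s)) ?_ ?_ ?_ ?_
  · exact ((ha.smooth.continuous.comp (by fun_prop)).pow 2).mul (by fun_prop)
  · refine DiskSupported.hasCompactSupport fun y hy => ?_
    have := ha.diskSupported_comp y hy
    simp_all
  · intro y
    positivity
  · simp [Real.sq_sqrt hs0.le, hs, hs0.ne']

end Fields

/-! ### Separated circular flows as weak Navier–Stokes solutions -/

section WeakForm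

variable {q γ : ℝ → ℝ}

theorem IsAnnular.isDivFree (hq : IsAnnular q) {v : L2Field}
    (hv : v =ᵐ[volume] fun x => swirl q (torusRep x)) : IsDivFree v := by
  intro ψ hψ
  rw [← integral_fderiv_swirl_eq_zero hq (ContDiff.of_le hψ (by exact_mod_cast le_top)),
    ← integral_comp_torusRep fun y hy => by simp [hq.diskSupported_swirl y hy]]
  refine integral_congr_ae ?_
  filter_upwards [hv] with x hx
  rw [hx, torusFDeriv]

theorem coeFn_smul_field (c : ℝ) (hq : IsAnnular q) :
    (c • hq.field : L2Field) =ᵐ[volume] fun x => c • swirl q (torusRep x) := by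
  filter_upwards [Lp.coeFn_smul c hq.field, hq.coeFn_field] with x h1 h2
  rw [h1, Pi.smul_apply, h2]

theorem IsAnnular.isDivFree_smul (hq : IsAnnular q) (c : ℝ) : IsDivFree (c • hq.field) := by
  refine (hq.mul_left (g := fun _ => c) fun _ _ => contDiffAt_const).isDivFree ?_
  filter_upwards [coeFn_smul_field c hq] with x hx
  rw [hx, swirl, swirl, mul_smul]

theorem IsAnnular.isDivFree_smul_sub {q₂ : ℝ → ℝ} (hq : IsAnnular q) (hq₂ : IsAnnular q₂)
    (c d : ℝ) : IsDivFree (c • hq.field - d • hq₂.field) := by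
  have h : IsAnnular fun s => c * q s - d * q₂ s :=
    ⟨(contDiff_const.mul hq.smooth).sub (contDiff_const.mul hq₂.smooth), fun s hs => by
      rw [hq.eq_zero s hs, hq₂.eq_zero s hs]; ring⟩
  refine h.isDivFree ?_
  filter_upwards [Lp.coeFn_sub (c • hq.field) (d • hq₂.field), coeFn_smul_field c hq,
    coeFn_smul_field d hq₂] with x h0 h1 h2
  rw [h0, Pi.sub_apply, h1, h2]
  simp only [swirl, sub_smul, mul_smul]

/-- The partial derivatives of a circular flow. -/
noncomputable def IsAnnular.partialField (hq : IsAnnular q) (i : Fin 2) : L2Field :=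
  diskField (fun y => fderiv ℝ (swirl q) y (planeBasis i))
    (((contDiff_swirl hq.smooth).continuous_fderiv (by simp)).clm_apply continuous_const)
    (hq.diskSupported_swirl.fderiv_apply _)

theorem IsAnnular.isWeakPartial_smul (hq : IsAnnular q) (c : ℝ) (i : Fin 2) :
    IsWeakPartial i (c • hq.field) (c • hq.partialField i) := by
  intro ψ hψ
  have hG : ContDiff ℝ 1 (swirl q) := (contDiff_swirl hq.smooth).of_le (by exact_mod_cast le_top)
  have h := integral_inner_fderiv_eq_neg (v := planeBasis i) hG
    (ContDiff.of_le hψ (by exact_mod_cast le_top)) hq.diskSupported_swirl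
  have e1 : ∫ x, inner ℝ ((c • hq.field : L2Field) x) (torusFDeriv ψ x (planeBasis i)) =
      c * ∫ y, inner ℝ (swirl q y) (fderiv ℝ (fun y => ψ (torusProj y)) y (planeBasis i)) := by
    rw [← integral_const_mul, ← integral_comp_torusRep fun y hy => by
      simp [hq.diskSupported_swirl y hy]]
    refine integral_congr_ae ?_
    filter_upwards [coeFn_smul_field c hq] with x hx
    rw [hx, torusFDeriv, real_inner_smul_left]
  have e2 : ∫ x, inner ℝ ((c • hq.partialField i : L2Field) x) (ψ x) =
      c * ∫ y, inner ℝ (fderiv ℝ (swirl q) y (planeBasis i)) (ψ (torusProj y)) := by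
    rw [← integral_const_mul, ← integral_comp_torusRep fun y hy => by
      simp [hq.diskSupported_swirl.fderiv_apply (planeBasis i) y hy]]
    refine integral_congr_ae ?_
    filter_upwards [Lp.coeFn_smul c (hq.partialField i), coeFn_diskField
      (((contDiff_swirl hq.smooth).continuous_fderiv (by simp)).clm_apply continuous_const)
      (hq.diskSupported_swirl.fderiv_apply (planeBasis i))] with x h1 h2
    rw [h1, Pi.smul_apply, IsAnnular.partialField, h2, torusProj_torusRep, real_inner_smul_left]
  rw [e1, e2, h, mul_neg]

/-- A separated circular flow solves the Navier-Stokes equations with force `∂ₜu - νΔu`. -/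
theorem weakMomentum_field (hq : IsAnnular q) (hγ : ContDiff ℝ ∞ γ)
    (hc : HasCompactSupport γ) (hpos : tsupport γ ⊆ Ioi 0) (ν T : ℝ) :
    WeakMomentum ν T 0 (fun t => deriv γ t • hq.field - (ν * γ t) • hq.laplaceProfile.field)
      fun t => γ t • hq.field := by
  intro ψ hψ
  let Ψ : ℝ × Plane → Plane := fun p => ψ p.1 (torusProj p.2)
  have hΨ : ContDiff ℝ ∞ Ψ := hψ.smooth
  have hγ' : Continuous (deriv γ) := (contDiff_infty_iff_deriv.1 hγ).2.continuous
  have hΨt : ∀ t, ContDiff ℝ ∞ fun y => ψ t (torusProj y) := fun t =>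
    hΨ.comp (contDiff_prodMk_right t)
  have hL := hq.laplaceProfile
  have cG := (contDiff_swirl hq.smooth).continuous
  have cL := (contDiff_swirl hL.smooth).continuous
  have sG := hq.diskSupported_swirl
  have sL := hL.diskSupported_swirl
  -- the time derivative of the pairing
  let g : ℝ × Plane → ℝ := fun p => γ p.1 * inner ℝ (swirl q p.2) (Ψ p)
  have hg : ContDiff ℝ 1 g := by
    have h : ContDiff ℝ ∞ g := (hγ.comp contDiff_fst).mul
      (((contDiff_swirl hq.smooth).comp contDiff_snd).inner ℝ hΨ)
    exact h.of_le (by exact_mod_cast le_top)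
  have hcomp : ∀ h : ℝ × Plane → ℝ, (∀ p, p.1 ∉ tsupport γ → h p = 0) →
      (∀ p, 1 < ‖p.2‖ → h p = 0) → HasCompactSupport h := fun h h1 h2 => by
    refine HasCompactSupport.intro (hc.isCompact.prod (isCompact_closedBall (0 : Plane) 1))
      fun p hp => ?_
    by_cases hp1 : p.1 ∈ tsupport γ
    · refine h2 p ?_
      by_contra hle
      exact hp ⟨hp1, by simpa using hle⟩
    · exact h1 p hp1
  have hgc : HasCompactSupport g := hcomp g
    (fun p hp => by simp [g, image_eq_zero_of_notMem_tsupport hp])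
    (fun p hp => by simp [g, sG p.2 hp])
  obtain ⟨hgi, hg0⟩ := integral_time_deriv_eq_zero hg hgc
  have hgd : ∀ t y, fderiv ℝ g (t, y) (1, 0) = deriv γ t * inner ℝ (swirl q y) (Ψ (t, y)) +
      γ t * inner ℝ (swirl q y) (deriv (fun s => Ψ (s, y)) t) := by
    intro t y
    have h1 : HasDerivAt (fun s => g (s, y)) (fderiv ℝ g (t, y) (1, 0)) t :=
      HasFDerivAt.comp_hasDerivAt (f := fun s => (s, y)) t
        (hg.differentiable one_ne_zero (t, y)).hasFDerivAt
        ((hasDerivAt_id t).prodMk (hasDerivAt_const t y))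
    have h2 : DifferentiableAt ℝ (fun s => Ψ (s, y)) t :=
      ((hΨ.comp (contDiff_prodMk_left y)).differentiable (by simp)) t
    have h3 := (hγ.differentiable (by simp) t).hasDerivAt.mul
      ((hasDerivAt_const t (swirl q y)).inner ℝ h2.hasDerivAt)
    rw [h1.unique h3]
    simp
  -- This allows the integral over `(0, T)` to be replaced by one over the line. For `t ≤ 0` the
  -- factor `γ` and its derivative vanish; for `t ≥ T` the test field vanishes near `t`, because `S
  -- < T`.
  have hout : ∀ t, t ∉ Ioo 0 T → ∫ y, fderiv ℝ g (t, y) (1, 0) = 0 := by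
    intro t ht
    obtain ⟨S, hST, hS⟩ := hψ.support
    refine integral_eq_zero_of_ae (ae_of_all _ fun y => (hgd t y).trans ?_)
    by_cases htγ : t ∈ tsupport γ
    · have hlt : S < t := by
        by_contra hle
        exact ht ⟨hpos htγ, by linarith⟩
      have hz : (fun s => Ψ (s, y)) =ᶠ[𝓝 t] fun _ => 0 := by
        filter_upwards [lt_mem_nhds hlt] with s hs
        exact hS s hs.le _
      rw [hz.deriv_eq, hz.eq_of_nhds]
      simp
    · rw [image_eq_zero_of_notMem_tsupport htγ, image_eq_zero_of_notMem_tsupport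
        fun h => htγ (tsupport_deriv_subset h)]
      simp
  -- the work of the force
  let r : ℝ × Plane → ℝ := fun p => deriv γ p.1 * inner ℝ (swirl q p.2) (Ψ p) -
    ν * γ p.1 * inner ℝ (swirl (laplaceProfile q) p.2) (Ψ p)
  have hr : Continuous r :=
    ((hγ'.comp continuous_fst).mul ((cG.comp continuous_snd).inner hΨ.continuous)).sub
      ((continuous_const.mul (hγ.continuous.comp continuous_fst)).mul
        ((cL.comp continuous_snd).inner hΨ.continuous))
  have hrc : HasCompactSupport r := hcomp r
    (fun p hp => by
      simp [r, image_eq_zero_of_notMem_tsupport hp, image_eq_zero_of_notMem_tsupport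
        fun h => hp (tsupport_deriv_subset h)])
    (fun p hp => by simp [r, sG p.2 hp, sL p.2 hp])
  have hri : Integrable fun t => ∫ y, r (t, y) :=
    (hr.integrable_of_hasCompactSupport (μ := volume.prod volume) hrc).integral_prod_left
  -- integrability of the spatial integrands
  have iG : ∀ B : Plane → Plane, Continuous B → Integrable fun y => inner ℝ (swirl q y) (B y) :=
    fun B hB => (cG.inner hB).integrable_of_hasCompactSupport
      (DiskSupported.hasCompactSupport fun y hy => by simp [sG y hy])
  have iL : ∀ B : Plane → Plane, Continuous B →
      Integrable fun y => inner ℝ (swirl (laplaceProfile q) y) (B y) :=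
    fun B hB => (cL.inner hB).integrable_of_hasCompactSupport
      (DiskSupported.hasCompactSupport fun y hy => by simp [sL y hy])
  have hrhs : ∀ t, ∫ x, inner ℝ ((deriv γ t • hq.field - (ν * γ t) • hL.field : L2Field) x)
      (ψ t x) = ∫ y, r (t, y) := by
    intro t
    rw [← integral_comp_torusRep (K := fun y => r (t, y))
      fun y hy => by simp [r, sG y hy, sL y hy]]
    refine integral_congr_ae ?_
    filter_upwards [Lp.coeFn_sub (deriv γ t • hq.field) ((ν * γ t) • hL.field),
      coeFn_smul_field (deriv γ t) hq, coeFn_smul_field (ν * γ t) hL] with x h0 h1 h2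
    rw [h0, Pi.sub_apply, h1, h2, inner_sub_left, real_inner_smul_left, real_inner_smul_left]
    simp only [r, Ψ]
    rw [torusProj_torusRep]
  -- At fixed time convection integrates to zero and the Laplacian moves onto the flow; what remains
  -- is the time derivative of the pairing minus the work of the force.
  have hlhs : ∀ t, ∫ x, (inner ℝ ((γ t • hq.field : L2Field) x) (deriv (fun s => ψ s x) t)
      + inner ℝ ((γ t • hq.field : L2Field) x)
          (torusFDeriv (ψ t) x ((γ t • hq.field : L2Field) x))
      + ν * inner ℝ ((γ t • hq.field : L2Field) x) (torusLaplacian (ψ t) x))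
      = (∫ y, fderiv ℝ g (t, y) (1, 0)) - ∫ y, r (t, y) := by
    intro t
    have hΨ2 : ContDiff ℝ 2 fun y => ψ t (torusProj y) := contDiff_infty.1 (hΨt t) 2
    have hΨ1 : ContDiff ℝ 1 fun y => ψ t (torusProj y) := hΨ2.of_le (by norm_num)
    have cdt : Continuous fun y => deriv (fun s => Ψ (s, y)) t := by
      have e : (fun y => deriv (fun s => Ψ (s, y)) t) = fun y => fderiv ℝ Ψ (t, y) (1, 0) := by
        funext y
        exact (HasFDerivAt.comp_hasDerivAt (f := fun s => (s, y)) t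
          (hΨ.differentiable (by simp) (t, y)).hasFDerivAt
          ((hasDerivAt_id t).prodMk (hasDerivAt_const t y))).deriv
      rw [e]
      exact ((hΨ.continuous_fderiv (by simp)).comp (by fun_prop)).clm_apply continuous_const
    have cfd : Continuous fun y => fderiv ℝ (fun y => ψ t (torusProj y)) y (swirl q y) :=
      (hΨ1.continuous_fderiv one_ne_zero).clm_apply cG
    have clap : Continuous fun y => Laplacian.laplacian (fun y => ψ t (torusProj y)) y := by
      simp only [laplacian_plane hΨ2]
      exact continuous_finsetSum _ fun i _ =>
        ((contDiff_fderiv_apply hΨ2 _).continuous_fderiv one_ne_zero).clm_apply continuous_const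
    have hconv := integral_convection_swirl_eq_zero hq hΨ1 fun y hy => by
      have h := hψ.divFree t (torusProj y)
      rwa [Fin.sum_univ_two, torusFDeriv, torusRep_torusProj (mem_torusCell_of_norm_le_one hy)] at h
    have hvisc := integral_inner_laplacian (A := swirl q)
      (contDiff_infty.1 (contDiff_swirl hq.smooth) 2) hΨ2 sG
    simp only [laplacian_swirl hq.smooth] at hvisc
    have step1 : ∫ x, (inner ℝ ((γ t • hq.field : L2Field) x) (deriv (fun s => ψ s x) t)
      + inner ℝ ((γ t • hq.field : L2Field) x)
          (torusFDeriv (ψ t) x ((γ t • hq.field : L2Field) x))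
      + ν * inner ℝ ((γ t • hq.field : L2Field) x) (torusLaplacian (ψ t) x)) =
      ∫ y, (γ t * inner ℝ (swirl q y) (deriv (fun s => Ψ (s, y)) t)
        + γ t ^ 2 * inner ℝ (swirl q y) (fderiv ℝ (fun y => ψ t (torusProj y)) y (swirl q y))
        + ν * γ t * inner ℝ (swirl q y)
          (Laplacian.laplacian (fun y => ψ t (torusProj y)) y)) := by
      rw [← integral_comp_torusRep fun y hy => by simp [sG y hy]]
      refine integral_congr_ae ?_
      filter_upwards [coeFn_smul_field (γ t) hq] with x hx
      rw [hx]
      simp only [torusFDeriv, torusLaplacian, Ψ, torusProj_torusRep, map_smul,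
        real_inner_smul_left, real_inner_smul_right]
      ring
    have i12 : Integrable fun y => γ t * inner ℝ (swirl q y) (deriv (fun s => Ψ (s, y)) t)
        + γ t ^ 2 * inner ℝ (swirl q y)
          (fderiv ℝ (fun y => ψ t (torusProj y)) y (swirl q y)) :=
      ((iG _ cdt).const_mul _).add ((iG _ cfd).const_mul _)
    rw [step1, integral_add i12 ((iG _ clap).const_mul _), integral_add ((iG _ cdt).const_mul _) ((iG _ cfd).const_mul _),
      integral_const_mul, integral_const_mul, integral_const_mul, hconv, hvisc]
    simp only [hgd, r]
    rw [integral_add ((iG _ (hΨt t).continuous).const_mul _) ((iG _ cdt).const_mul _),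
      integral_sub ((iG _ (hΨt t).continuous).const_mul _)
        ((iL _ (hΨt t).continuous).const_mul _),
      integral_const_mul, integral_const_mul, integral_const_mul]
    ring
  have h0 : ∫ x, inner ℝ ((0 : L2Field) x) (ψ 0 x) = 0 := by
    refine integral_eq_zero_of_ae ?_
    filter_upwards [Lp.coeFn_zero Plane 2 (volume : Measure FlatTorus)] with x hx
    rw [hx]
    simp
  simp only [hlhs, hrhs]
  rw [h0, integral_sub hgi.integrableOn hri.integrableOn,
    setIntegral_eq_integral_of_forall_compl_eq_zero hout, hg0]
  ring

end WeakForm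

/-! ### Convergence of products of a time factor and a spatial field -/

section Separated

variable {c : ℝ → ℝ}

theorem memLp_smul_const (hc : Continuous c) (hs : HasCompactSupport c) (V : L2Field)
    (p : ℝ≥0∞) (T : ℝ) : MemLp (fun t => c t • V) p (timeMeasure T) :=
  (ContinuousLinearMap.toSpanSingleton ℝ V).comp_memLp'
    (hc.memLp_of_hasCompactSupport (μ := timeMeasure T) hs)

/-- The map `V ↦ c ⊗ V` from `L²(𝕋²)` to `L^p(0,T; L²(𝕋²))`. -/
noncomputable def tensorLift (p : ℝ≥0∞) [Fact (1 ≤ p)] (T : ℝ) (c : Lp ℝ p (timeMeasure T)) :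
    L2Field →L[ℝ] Lp L2Field p (timeMeasure T) :=
  ((ContinuousLinearMap.lsmul ℝ ℝ (E := L2Field)).flip.compLpL₂ p (timeMeasure T)).flip c

theorem coeFn_tensorLift {p : ℝ≥0∞} [Fact (1 ≤ p)] {T : ℝ} (hc : MemLp c p (timeMeasure T))
    (V : L2Field) : tensorLift p T (hc.toLp c) V =ᵐ[timeMeasure T] fun t => c t • V := by
  have h := ContinuousLinearMap.coeFn_compLp
    ((ContinuousLinearMap.lsmul ℝ ℝ (E := L2Field)).flip V) (hc.toLp c)
  filter_upwards [h, hc.coeFn_toLp] with t h1 h2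
  rw [h2] at h1
  exact h1

theorem tendsto_strongDual_of_tendsto_inner {U : ℕ → L2Field}
    (hU : ∀ V, Tendsto (fun n => inner ℝ (U n) V) atTop (𝓝 0)) (ℓ : StrongDual ℝ L2Field) :
    Tendsto (fun n => ℓ (U n)) atTop (𝓝 0) := by
  refine (hU ((InnerProductSpace.toDual ℝ L2Field).symm ℓ)).congr fun n => ?_
  rw [real_inner_comm, InnerProductSpace.toDual_symm_apply]

/-- Composing a functional on `L^p(0,T; L²)` with `V ↦ c ⊗ V` gives a functional on `L²(𝕋²)`. Weak
convergence of the spatial factors therefore suffices for every `p`, with no description of the dual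
space. -/
theorem weakTendsto_separated {p : ℝ≥0∞} [Fact (1 ≤ p)] {T : ℝ} {d : ℝ → ℝ}
    (hc : Continuous c) (hcs : HasCompactSupport c) (hd : Continuous d)
    (hds : HasCompactSupport d) {ν : ℕ → ℝ} {U W : ℕ → L2Field}
    (hU : ∀ V, Tendsto (fun n => inner ℝ (U n) V) atTop (𝓝 0))
    (hW : Tendsto (fun n => ν n • W n) atTop (𝓝 0)) :
    WeakTendsto p T (fun n t => c t • U n - (ν n * d t) • W n) 0 := by
  have mc := hc.memLp_of_hasCompactSupport (p := p) (μ := timeMeasure T) hcs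
  have md := hd.memLp_of_hasCompactSupport (p := p) (μ := timeMeasure T) hds
  refine ⟨fun n => ?_, MemLp.zero, fun ℓ => ?_⟩
  · exact (memLp_smul_const hc hcs (U n) p T).sub
      (memLp_smul_const (hd.const_mul (ν n)) (hds.mul_left (f := fun _ => ν n)) (W n) p T)
  · have e0 : (MemLp.zero : MemLp (0 : ℝ → L2Field) p (timeMeasure T)).toLp 0 = 0 :=
      MemLp.toLp_zero _
    rw [e0, map_zero]
    have h1 := tendsto_strongDual_of_tendsto_inner hU (ℓ.comp (tensorLift p T (mc.toLp c)))
    have h2 := ((ℓ.comp (tensorLift p T (md.toLp d))).continuous.tendsto 0).comp hW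
    rw [map_zero] at h2
    have h3 := h1.sub h2
    rw [sub_zero] at h3
    refine h3.congr fun n => ?_
    simp only [Function.comp, ContinuousLinearMap.comp_apply]
    rw [← map_sub]
    congr 1
    refine Lp.ext ?_
    filter_upwards [Lp.coeFn_sub (tensorLift p T (mc.toLp c) (U n))
        (tensorLift p T (md.toLp d) (ν n • W n)), coeFn_tensorLift mc (U n),
      coeFn_tensorLift md (ν n • W n),
      MemLp.coeFn_toLp ((memLp_smul_const hc hcs (U n) p T).sub
        (memLp_smul_const (hd.const_mul (ν n)) (hds.mul_left (f := fun _ => ν n)) (W n) p T))]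
      with t h1 h2 h3 h4
    refine h1.trans (Eq.trans ?_ h4.symm)
    rw [Pi.sub_apply, h2, h3, Pi.sub_apply, smul_smul, mul_comm (d t)]

/-- The time integral passes inside the inner product, leaving `U n` tested against the single field
`∫ c w`. -/
theorem weakStarTendsto_separated {T : ℝ} (hc : Continuous c) (hcs : HasCompactSupport c)
    {U : ℕ → L2Field} (hU : ∀ V, Tendsto (fun n => inner ℝ (U n) V) atTop (𝓝 0)) :
    WeakStarTendsto T (fun n t => c t • U n) 0 := by
  refine ⟨fun n => memLp_smul_const hc hcs _ _ _, MemLp.zero, fun w hw => ?_⟩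
  have hw1 : Integrable w (timeMeasure T) := memLp_one_iff_integrable.1 hw
  obtain ⟨C, hC⟩ := hc.bounded_above_of_compact_support hcs
  have hi : Integrable (fun t => c t • w t) (timeMeasure T) :=
    hw1.bdd_smul C hc.aestronglyMeasurable (ae_of_all _ hC)
  simp only [Pi.zero_apply, inner_zero_left, integral_zero]
  refine (hU (∫ t in Ioo 0 T, c t • w t)).congr fun n => ?_
  rw [← integral_inner hi]
  simp only [real_inner_smul_left, real_inner_smul_right]

/-- The space-time norm factors as `‖U n‖` times the norm of `c`. Both the limit of the first factor
and the second factor are nonzero, the latter because a continuous function vanishing a.e. on an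
open interval vanishes there. -/
theorem not_strongL2Tendsto_separated {T : ℝ} (hc : Continuous c)
    (hne : ∃ t ∈ Ioo 0 T, c t ≠ 0) {U : ℕ → L2Field} {m : ℝ} (hm : 0 < m)
    (hU : Tendsto (fun n => ‖U n‖ ^ 2) atTop (𝓝 m)) :
    ¬ StrongL2Tendsto T (fun n t => c t • U n) 0 := by
  intro h
  have hc0 : eLpNorm c 2 (timeMeasure T) ≠ 0 := by
    rw [Ne, eLpNorm_eq_zero_iff hc.aestronglyMeasurable (by norm_num)]
    intro h0
    obtain ⟨t, ht, hct⟩ := hne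
    have := Measure.eqOn_open_of_ae_eq h0 isOpen_Ioo hc.continuousOn continuousOn_const
    exact hct (this ht)
  have e : ∀ n, eLpNorm (fun t => c t • U n - (0 : ℝ → L2Field) t) 2 (timeMeasure T) =
      ‖U n‖ₑ * eLpNorm c 2 (timeMeasure T) := fun n => by
    rw [← enorm_norm (U n), ← eLpNorm_const_smul]
    refine eLpNorm_congr_norm_ae (ae_of_all _ fun t => ?_)
    simp [norm_smul, mul_comm]
  simp only [StrongL2Tendsto, e] at h
  have hn : Tendsto (fun n => ‖U n‖) atTop (𝓝 (√m)) := by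
    refine (Real.continuous_sqrt.tendsto m |>.comp hU).congr fun n => ?_
    simp
  have hn2 : Tendsto (fun n => ‖U n‖ₑ) atTop (𝓝 (ENNReal.ofReal √m)) := by
    refine (ENNReal.tendsto_ofReal hn).congr fun n => ?_
    exact ofReal_norm (U n)
  have hpos : ENNReal.ofReal √m ≠ 0 := by simpa using hm
  have h3 := ENNReal.Tendsto.mul_const (b := eLpNorm c 2 (timeMeasure T)) hn2 (.inl hpos)
  exact mul_ne_zero hpos hc0 (tendsto_nhds_unique h3 h)

theorem not_tendstoUniformlyOn_separated {T : ℝ} (hne : ∃ t ∈ Ioo 0 T, c t ≠ 0)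
    {U : ℕ → L2Field} {m : ℝ} (hm : 0 < m) (hU : Tendsto (fun n => ‖U n‖ ^ 2) atTop (𝓝 m)) :
    ¬ TendstoUniformlyOn (fun n t => c t • U n) (0 : ℝ → L2Field) atTop (Icc 0 T) := by
  intro h
  obtain ⟨t, ht, hct⟩ := hne
  have h1 := ((h.tendsto_at (Ioo_subset_Icc_self ht)).norm.pow 2)
  simp only [norm_smul, mul_pow, Pi.zero_apply, norm_zero] at h1
  have h2 := tendsto_nhds_unique h1 (hU.const_mul (‖c t‖ ^ 2))
  have : 0 < ‖c t‖ ^ 2 * m := by positivity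
  norm_num at h2
  rcases h2 with h2 | h2
  · exact hct h2
  · exact hm.ne' h2

end Separated

/-! ### The zero Euler flow -/

section ZeroFlow

theorem isDivFree_zero : IsDivFree 0 := by
  intro ψ _
  refine integral_eq_zero_of_ae ?_
  filter_upwards [Lp.coeFn_zero Plane 2 (volume : Measure FlatTorus)] with x hx
  rw [hx]
  simp

theorem isFlowData_zero (T : ℝ) : IsFlowData T 0 0 :=
  ⟨isDivFree_zero, MemLp.zero, ae_of_all _ fun _ => isDivFree_zero⟩

theorem isEulerSolution_zero (T : ℝ) : IsEulerSolution T 0 0 0 where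
  data := isFlowData_zero T
  memLp := MemLp.zero
  momentum := by
    intro ψ _
    have h : ∀ g : FlatTorus → Plane, ∫ x, inner ℝ ((0 : L2Field) x) (g x) = 0 := fun g => by
      refine integral_eq_zero_of_ae ?_
      filter_upwards [Lp.coeFn_zero Plane 2 (volume : Measure FlatTorus)] with x hx
      rw [hx]
      simp
    have h2 : ∀ t, ∫ x, (inner ℝ ((0 : L2Field) x) (deriv (fun s => ψ s x) t)
        + inner ℝ ((0 : L2Field) x) (torusFDeriv (ψ t) x ((0 : L2Field) x))
        + 0 * inner ℝ ((0 : L2Field) x) (torusLaplacian (ψ t) x)) = 0 := fun t => by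
      refine integral_eq_zero_of_ae ?_
      filter_upwards [Lp.coeFn_zero Plane 2 (volume : Measure FlatTorus)] with x hx
      rw [hx]
      simp
    simp only [Pi.zero_apply, h, h2, integral_zero, add_zero, neg_zero]
  divFree := ae_of_all _ fun _ => isDivFree_zero

theorem isEnergyBalanced_zero (T : ℝ) : IsEnergyBalanced T 0 0 0 :=
  ⟨isEulerSolution_zero T, ae_of_all _ fun t => by simp⟩

end ZeroFlow

/-! ### The oscillating vortex -/

section Vortex

variable {T : ℝ} {φ γ : ℝ → ℝ}

/-- The squared-radius amplitude of the oscillating vortex. -/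
noncomputable def vortexAmplitude (φ : ℝ → ℝ) (s : ℝ) : ℝ := φ √s / s

theorem IsProfilePair.isAnnular (h : IsProfilePair T φ γ) : IsAnnular (vortexAmplitude φ) := by
  refine isAnnular_of_contDiffAt (fun s hs => ?_) fun s hs => ?_
  · exact (h.smooth_radial.contDiffAt.comp s (Real.contDiffAt_sqrt hs.ne')).div contDiffAt_id hs.ne'
  · have : φ √s = 0 := by
      by_contra hne
      obtain ⟨h1, h2⟩ := h.support_radial hne
      refine hs ⟨?_, ?_⟩
      · rw [Real.le_sqrt' (by norm_num)] at h1
        linarith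
      · simpa using h2
    rw [vortexAmplitude, this, zero_div]

theorem IsProfilePair.exists_ne_zero (h : IsProfilePair T φ γ) :
    ∃ s, vortexAmplitude φ s ≠ 0 := by
  obtain ⟨r, hr⟩ := h.ne_zero_radial
  have h0 : 0 < r := by linarith [(h.support_radial hr).1]
  exact ⟨r ^ 2, by simp [vortexAmplitude, Real.sqrt_sq h0.le, hr, h0.ne']⟩

theorem vortexVelocity_eq (φ γ : ℝ → ℝ) (ν t : ℝ) : vortexVelocity φ γ ν t = fun x =>
    γ t • swirl (sinProfile (ν ^ (1 / 3 : ℝ))⁻¹ (vortexAmplitude φ)) (torusRep x) := by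
  funext x
  rw [vortexVelocity, swirl, sinProfile_norm_sq, vortexAmplitude, Real.sqrt_sq (norm_nonneg _),
    smul_smul, div_eq_inv_mul _ (ν ^ (1 / 3 : ℝ))]
  congr 1
  ring

theorem vortexForce_eq (h : IsProfilePair T φ γ) (ν t : ℝ) : vortexForce φ γ ν t = fun x =>
    deriv γ t • swirl (sinProfile (ν ^ (1 / 3 : ℝ))⁻¹ (vortexAmplitude φ)) (torusRep x)
    - (ν * γ t) • swirl (laplaceProfile (sinProfile (ν ^ (1 / 3 : ℝ))⁻¹ (vortexAmplitude φ)))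
      (torusRep x) := by
  funext x
  have hq := h.isAnnular.sinProfile (ν ^ (1 / 3 : ℝ))⁻¹
  set q := sinProfile (ν ^ (1 / 3 : ℝ))⁻¹ (vortexAmplitude φ)
  have h1 : deriv (fun s => vortexVelocity φ γ ν s x) t = deriv γ t • swirl q (torusRep x) := by
    simp only [vortexVelocity_eq]
    exact deriv_smul_const (h.smooth_time.differentiable (by simp) t) _
  have h2 : torusLaplacian (vortexVelocity φ γ ν t) x =
      γ t • swirl (laplaceProfile q) (torusRep x) := by
    rw [vortexVelocity_eq, DiskSupported.torusLaplacian_eq (G := fun y => γ t • swirl q y)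
      fun y hy => by simp [hq.diskSupported_swirl y hy]]
    have := InnerProductSpace.laplacian_smul (𝕜 := ℝ) (f := swirl q) (x := torusRep x) (γ t)
      (contDiff_infty.1 (contDiff_swirl hq.smooth) 2).contDiffAt
    rw [← laplacian_swirl hq.smooth]
    exact this
  rw [vortexForce, h1, h2, smul_smul]

theorem exists_isProfilePair (hT : 0 < T) : ∃ φ γ : ℝ → ℝ, IsProfilePair T φ γ := by
  -- The outer radii give supports `(1/2, 1)` for `b` and `(T/4, 3T/4)` for `d`.
  let b : ContDiffBump (3 / 4 : ℝ) := ⟨1 / 8, 1 / 4, by norm_num, by norm_num⟩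
  let d : ContDiffBump (T / 2) := ⟨T / 8, T / 4, by positivity, by linarith⟩
  refine ⟨b, d, b.contDiff, ?_, ⟨3 / 4, ?_⟩, d.contDiff, d.hasCompactSupport, ?_, T / 2, ?_, ?_⟩
  · rw [b.support_eq, Real.ball_eq_Ioo]
    intro x hx
    simp only [b] at hx
    constructor <;> linarith [hx.1, hx.2]
  · rw [b.one_of_mem_closedBall (by simp [b])]
    exact one_ne_zero
  · rw [d.tsupport_eq, Real.closedBall_eq_Icc]
    intro x hx
    simp only [d] at hx
    exact mem_Ioi.2 (by linarith [hx.1])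
  · constructor <;> linarith
  · rw [d.one_of_mem_closedBall (by simp [d]; positivity)]
    exact one_ne_zero

theorem tendsto_frequency_atTop {ν : ℕ → ℝ} (hν : ∀ n, 0 < ν n)
    (hν0 : Tendsto ν atTop (𝓝 0)) : Tendsto (fun n => (ν n ^ (1 / 3 : ℝ))⁻¹) atTop atTop := by
  refine Tendsto.inv_tendsto_nhdsGT_zero (tendsto_nhdsWithin_iff.2 ⟨?_, ?_⟩)
  · have := (Real.continuousAt_rpow_const 0 (1 / 3) (.inr (by norm_num))).tendsto.comp hν0
    rwa [Real.zero_rpow (by norm_num)] at this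
  · exact Eventually.of_forall fun n => Real.rpow_pos_of_pos (hν n) _

/-- Here the exponent `1/3` matters: being positive it sends the frequency to infinity, being less
than `1/2` it keeps `ν κ²` small. -/
theorem IsAnnular.tendsto_viscous_field {a : ℝ → ℝ} (ha : IsAnnular a) {ν : ℕ → ℝ}
    (hν : ∀ n, 0 < ν n) (hν0 : Tendsto ν atTop (𝓝 0)) :
    Tendsto (fun n => ν n • (ha.sinProfile (ν n ^ (1 / 3 : ℝ))⁻¹).laplaceProfile.field)
      atTop (𝓝 0) := by
  obtain ⟨C, hC⟩ := ha.exists_laplaceProfile_bound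
  let M : ℝ := (measureUnivNNReal (volume : Measure FlatTorus)) ^ (2 : ℝ≥0∞).toReal⁻¹
  have hμ : Tendsto (fun n => ν n ^ (1 / 3 : ℝ)) atTop (𝓝 0) := by
    have := (Real.continuousAt_rpow_const 0 (1 / 3) (.inr (by norm_num))).tendsto.comp hν0
    rwa [Real.zero_rpow (by norm_num)] at this
  -- With `μ = ν^(1/3)`, the bound is `ν (1 + 1/μ)² = μ (μ + 1)²`.
  have hlim : Tendsto (fun n => M * C * (ν n ^ (1 / 3 : ℝ) * (ν n ^ (1 / 3 : ℝ) + 1) ^ 2))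
      atTop (𝓝 0) := by
    have := (hμ.mul ((hμ.add_const 1).pow 2)).const_mul (M * C)
    simpa using this
  refine squeeze_zero_norm (fun n => ?_) hlim
  have hpos : 0 < ν n ^ (1 / 3 : ℝ) := Real.rpow_pos_of_pos (hν n) _
  have hcube : ν n = (ν n ^ (1 / 3 : ℝ)) ^ 3 := by
    rw [← Real.rpow_natCast, ← Real.rpow_mul (hν n).le]
    norm_num
  have hq := (ha.sinProfile (ν n ^ (1 / 3 : ℝ))⁻¹).laplaceProfile
  have hb : ‖hq.field‖ ≤ M * (C * (1 + (ν n ^ (1 / 3 : ℝ))⁻¹) ^ 2) :=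
    norm_diskField_le _ _ (hq.norm_swirl_le (hC _ (by positivity)))
  rw [norm_smul, Real.norm_of_nonneg (hν n).le]
  refine (mul_le_mul_of_nonneg_left hb (hν n).le).trans_eq ?_
  generalize ν n ^ (1 / 3 : ℝ) = μ at *
  rw [hcube]
  field_simp

/-- The oscillating vortices are a physical realization of the zero flow with weakly convergent
forces, without strong convergence. -/
theorem IsProfilePair.exists_realization (h : IsProfilePair T φ γ) {ν : ℕ → ℝ}
    (hν : ∀ n, 0 < ν n) (hν0 : Tendsto ν atTop (𝓝 0)) :
    ∃ uν fν : ℕ → ℝ → L2Field,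
      (∀ n t, uν n t =ᵐ[volume] vortexVelocity φ γ (ν n) t) ∧
      (∀ n t, fν n t =ᵐ[volume] vortexForce φ γ (ν n) t) ∧
      (∀ n, uν n 0 = 0) ∧
      IsPhysicalRealization T 0 0 0 ν (fun _ => 0) fν uν ∧
      WeakTendsto 2 T fν 0 ∧
      ¬ StrongL2Tendsto T uν 0 ∧
      ¬ TendstoUniformlyOn uν 0 atTop (Icc 0 T) := by
  have ha := h.isAnnular
  have hq := fun n => ha.sinProfile (ν n ^ (1 / 3 : ℝ))⁻¹
  have hκ := tendsto_frequency_atTop hν hν0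
  have hγ := h.smooth_time.continuous
  have hγ' : Continuous (deriv γ) := (contDiff_infty_iff_deriv.1 h.smooth_time).2.continuous
  have hγs := h.compact_time
  have hU : ∀ V, Tendsto (fun n => inner ℝ (hq n).field V) atTop (𝓝 0) := fun V =>
    (ha.tendsto_inner_field V).comp hκ
  have hW := ha.tendsto_viscous_field hν hν0
  have hm : 0 < (1 / 2) * ∫ y : Plane, vortexAmplitude φ (‖y‖ ^ 2) ^ 2 * ‖y‖ ^ 2 :=
    mul_pos (by norm_num) (ha.integral_sq_pos h.exists_ne_zero)
  have hN := ha.tendsto_norm_field.comp hκ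
  have hf : ∀ p : ℝ≥0∞, [Fact (1 ≤ p)] → WeakTendsto p T (fun n t =>
      deriv γ t • (hq n).field - (ν n * γ t) • (hq n).laplaceProfile.field) 0 := fun p _ =>
    weakTendsto_separated hγ' hγs.deriv hγ hγs hU hW
  refine ⟨fun n t => γ t • (hq n).field,
    fun n t => deriv γ t • (hq n).field - (ν n * γ t) • (hq n).laplaceProfile.field,
    fun n t => ?_, fun n t => ?_, fun n => ?_, ?_, hf 2,
    not_strongL2Tendsto_separated hγ h.ne_zero_time hm hN,
    not_tendstoUniformlyOn_separated h.ne_zero_time hm hN⟩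
  · rw [vortexVelocity_eq]
    exact coeFn_smul_field _ _
  · rw [vortexForce_eq h]
    filter_upwards [Lp.coeFn_sub (deriv γ t • (hq n).field)
      ((ν n * γ t) • (hq n).laplaceProfile.field), coeFn_smul_field (deriv γ t) (hq n),
      coeFn_smul_field (ν n * γ t) (hq n).laplaceProfile] with x h0 h1 h2
    rw [h0, Pi.sub_apply, h1, h2]
  · have : γ 0 = 0 := image_eq_zero_of_notMem_tsupport fun h0 =>
      lt_irrefl (0 : ℝ) (h.support_time h0)
    simp only [this, zero_smul]
  · refine ⟨isEulerSolution_zero T, hν, hν0, fun n => ⟨⟨isDivFree_zero, ?_, ?_⟩, ?_, ⟨?_, ?_⟩,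
      ?_, ?_⟩, tendsto_const_nhds, hf 1, weakStarTendsto_separated hγ hγs hU⟩
    · exact (hf 1).1 n
    · exact ae_of_all _ fun t => (hq n).isDivFree_smul_sub (hq n).laplaceProfile _ _
    · exact memLp_smul_const hγ hγs _ _ _
    · exact memLp_smul_const hγ hγs _ _ _
    · exact fun i => ⟨fun t => γ t • (hq n).partialField i, memLp_smul_const hγ hγs _ _ _,
        ae_of_all _ fun t => (hq n).isWeakPartial_smul _ i⟩
    · exact weakMomentum_field (hq n) h.smooth_time hγs h.support_time _ _
    · exact ae_of_all _ fun t => (hq n).isDivFree_smul _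

end Vortex

/-! ### The counterexample -/

theorem mainTheorem9 (T : ℝ) (hT : 0 < T) :
    -- `u ≡ 0` is a physically realizable, energy balanced solution with force `f ≡ 0`
    IsPhysicallyRealizable T 0 0 0 ∧ IsEnergyBalanced T 0 0 0 ∧
    -- profiles exist, and all of them give the counterexample, along every sequence `ν n → 0`
    (∃ φ γ : ℝ → ℝ, IsProfilePair T φ γ) ∧
    (∀ φ γ : ℝ → ℝ, IsProfilePair T φ γ →
      ∀ ν : ℕ → ℝ, (∀ n, 0 < ν n) → Tendsto ν atTop (𝓝 0) →
        ∃ uν fν : ℕ → ℝ → L2Field,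
          (∀ n t, uν n t =ᵐ[volume] vortexVelocity φ γ (ν n) t) ∧
          (∀ n t, fν n t =ᵐ[volume] vortexForce φ γ (ν n) t) ∧
          (∀ n, uν n 0 = 0) ∧
          IsPhysicalRealization T 0 0 0 ν (fun _ => 0) fν uν ∧
          WeakTendsto 2 T fν 0 ∧
          ¬ StrongL2Tendsto T uν 0 ∧
          ¬ TendstoUniformlyOn uν 0 atTop (Icc 0 T)) ∧
    -- energy balance does not imply strong convergence if the forces only converge weakly
    ¬ (∀ (u₀ : L2Field) (f u : ℝ → L2Field) (ν : ℕ → ℝ) (uν₀ : ℕ → L2Field)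
        (fν uν : ℕ → ℝ → L2Field),
        IsPhysicalRealization T u₀ f u ν uν₀ fν uν → WeakTendsto 2 T fν f →
        IsEnergyBalanced T u₀ f u → StrongL2Tendsto T uν u) := by
  obtain ⟨φ, γ, h⟩ := exists_isProfilePair hT
  have hν : ∀ n : ℕ, (0 : ℝ) < 1 / ((n : ℝ) + 1) := fun n => Nat.one_div_pos_of_nat
  have hν0 : Tendsto (fun n : ℕ => 1 / ((n : ℝ) + 1)) atTop (𝓝 0) :=
    tendsto_one_div_add_atTop_nhds_zero_nat
  obtain ⟨uν, fν, -, -, -, hreal, hweak, hstrong, -⟩ := h.exists_realization hν hν0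
  exact ⟨⟨_, _, _, _, hreal⟩, isEnergyBalanced_zero T, ⟨φ, γ, h⟩,
    fun _ _ h _ hν hν0 => h.exists_realization hν hν0,
    fun H => hstrong (H _ _ _ _ _ _ _ hreal hweak (isEnergyBalanced_zero T))⟩
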